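/- Let $j,l\ge 1$ be integers. An urn initially contains $1$ black ball and $j$ white balls. At each step a ball is drawn uniformly at random and put back together with another ball of the same color; in addition, after every $l$-th draw (that is, after draws $l,2l,3l,\dots$) one extra black ball is added. Let $W_n$ be the number of white balls in the urn after $n$ draws (and after the extra black balls due up to then have been added), let $\mathscr{L}(X)$ denote the law of a random variable $X$, and let $\mu_n>0$ be defined by $$\mu_n^{l+1}=\frac{l+1}{j}\,\mathbb{E}\,W_n^{l+1}.$$ For $k,r>0$ let $\mathrm{GG}(k,r)$ be the generalized gamma distribution, i.e. the law of $X^{1/r}$ where $X$ has the gamma distribution with density $x^{k/r-1}e^{-x}/\Gamma(k/r)$ on $x>0$; for probability laws $P,Q$ on $\mathbb{R}$ let $d_{\mathrm K}(P,Q)=\sup_{x\in\mathbb{R}}|P((-\infty,x])-Q((-\infty,x])|$ be the Kolmogorov distance. Then $\mu_n\asymp n^{l/(l+1)}$, i.e. there are constants $a,A>0$ depending only on $j,l$ with $a\,n^{l/(l+1)}\le\mu_n\le A\,n^{l/(l+1)}$ for all $n\ge1$, and there are constants $c,C>0$ depending only on $j,l$ such that for all $n\ge 1$ $$c\,n^{-l/(l+1)}\le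 d_{\mathrm K}\bigl(\mathscr{L}(W_n/\mu_n),\mathrm{GG}(j,l+1)\bigr)\le C\,n^{-l/(l+1)}.$$ -/

import Mathlib

open MeasureTheory ProbabilityTheory
open scoped NNReal

/-- The probability of drawing a white ball from an urn holding `b` black and `w` white balls. -/
noncomputable def whiteProb (b w : ℕ) : ℝ≥0 := (w : ℝ≥0) / ((b : ℝ≥0) + (w : ℝ≥0))

theorem whiteProb_le_one (b w : ℕ) : whiteProb b w ≤ 1 :=
  div_le_one_of_le₀ le_add_self zero_le

/-- The color of a ball drawn uniformly from an urn holding `b` black and `w` white balls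
(`true` means white). -/
noncomputable def drawnColor (b w : ℕ) : PMF Bool :=
  PMF.ofFintype (fun white => if white then (whiteProb b w : ENNReal)
      else ((1 - whiteProb b w : ℝ≥0) : ENNReal)) (by
    simp only [Fintype.sum_bool, if_true, Bool.false_eq_true, if_false]
    rw [← ENNReal.coe_add, add_tsub_cancel_of_le (whiteProb_le_one b w), ENNReal.coe_one])

/-- The law of `(black, white)` after a single draw from an urn with contents `s = (black, white)`,
the drawn ball being replaced along with another ball of the same color, and `e` extra black balls
being added afterwards. -/
noncomputable def urnStep (e : ℕ) (s : ℕ × ℕ) : PMF (ℕ × ℕ) :=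
  (drawnColor s.1 s.2).map
    (fun white : Bool => if white then (s.1 + e, s.2 + 1) else (s.1 + 1 + e, s.2))

/-- The law of the urn contents `(black, white)` after a number of draws, starting from
`b` black and `w` white balls, when an extra black ball is added after every `l`-th draw. -/
noncomputable def urnState (l b w : ℕ) : ℕ → PMF (ℕ × ℕ)
  | 0 => PMF.pure (b, w)
  | n + 1 => (urnState l b w n).bind (urnStep (if l ∣ n + 1 then 1 else 0))

/-- The law of the number of white balls after `n` draws, as a probability measure on `ℝ`. -/
noncomputable def whiteLaw (l b w n : ℕ) : Measure ℝ :=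
  (urnState l b w n).toMeasure.map (fun s : ℕ × ℕ => (s.2 : ℝ))

/-- The generalized gamma distribution with parameters `k, r > 0`: the law of `X ^ (1 / r)`
where `X` has the gamma distribution with shape `k / r` and rate `1`. -/
noncomputable def genGamma (k r : ℝ) : Measure ℝ :=
  (gammaMeasure (k / r) 1).map (fun x : ℝ => x ^ (1 / r))

/-- The Kolmogorov distance between two probability measures on `ℝ`. -/
noncomputable def kolmogorovDist (P Q : Measure ℝ) : ℝ :=
  ⨆ x : ℝ, |P.real (Set.Iic x) - Q.real (Set.Iic x)|

/-- The scaling `μ_n`, the nonnegative number with `μ_n ^ (l + 1) = ((l + 1) / j) * E W_n ^ (l + 1)`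
where `W_n` is the number of white balls after `n` draws from `1` black and `j` white balls. -/
noncomputable def urnScale (j l n : ℕ) : ℝ :=
  (((l : ℝ) + 1) / (j : ℝ) * ∫ x, x ^ (l + 1) ∂(whiteLaw l 1 j n)) ^ (1 / ((l : ℝ) + 1))

/-! Put `J = j - 1` and divide the probability of `i + J + 1` white balls by `(i + J).choose J`; the
quotient is `profile`, and it is nonincreasing in `i`. The core of the proof is the exact identity
`profile_add_sub`: the drop of the profile from `i` to `i + 1` at time `m + l` equals `rate l J m`
times the falling factorial of `i` of order `l` times the profile at `i - l` at time `m`. It comes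
from `total (n + l) = total n + (l + 1)`, which is the effect of the extra black balls. On the scale
`μ` of the theorem the identity is a discrete form of `u' = -(l + 1) x ^ l u`, whose solution is a
multiple of `exp (-x ^ (l + 1))`. Multiplied by the binomial coefficient, of order `i ^ J`, this
becomes the generalized gamma density. The factor `(l + 1) / j` in the definition of `μ` is what
makes the constant of the equation `l + 1`, up to relative error `O(1/μ)`. To make this
quantitative, monotonicity and rising factorial moments give decay of the profile of every
polynomial order, and the identity turns this into bounds on its differences in space and time
(`exists_profile_shift_le`). A discrete Gronwall argument with polynomial weights then compares
profile and shape (`exists_profile_sub_shape_le`). Summation yields an `O(1/μ)` bound on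
distribution functions, in which the unknown leading constant is fixed by total mass one
(`exists_sum_mass_sub_limitCdf_le`). The lower bound holds because the rescaled count lives on a
lattice of mesh `1/μ` while the limit has a density (`exists_le_iSup_abs_sub`). The order of `μ`
comes from a telescoping product (`growth_mul_prod`). -/

namespace ImmigrationUrn

/-! ### Urn size, profile, and the exact difference identity. -/

/-- The number of balls after `n` draws, starting from `1` black and `J + 1` white balls. -/
def total (l J n : ℕ) : ℕ := J + 2 + n + n / l

/-- The ratio of the probability of having `i + J + 1` white balls after `n` draws
to `(i + J).choose J`. -/
noncomputable def profile (l J : ℕ) : ℕ → ℕ → ℝ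
  | 0, i => if i = 0 then 1 else 0
  | n + 1, i => (1 - (i + J + 1) / total l J n) * profile l J n i +
      i / total l J n * profile l J n (i - 1)

/-- The product by which the mean of the rising factorial of order `q` of the number of white
balls grows during the first `n` draws. -/
noncomputable def growth (l J q n : ℕ) : ℝ := ∏ i ∈ Finset.range n, (1 + (q : ℝ) / total l J i)

/-- The probability of having `i + J + 1` white balls after `n` draws. -/
noncomputable def mass (l J n i : ℕ) : ℝ :=
  ((i + 1).ascFactorial J : ℝ) / (J.factorial : ℝ) * profile l J n i

variable {l J : ℕ}

theorem total_pos (n : ℕ) : (0 : ℝ) < total l J n := by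
  unfold total; positivity

theorem le_cast_total (n : ℕ) : (n : ℝ) + J + 2 ≤ total l J n := by
  have : n + J + 2 ≤ total l J n := by
    unfold total
    exact le_trans (by omega) (Nat.le_add_right (J + 2 + n) (n / l))
  exact_mod_cast this

theorem total_mono : Monotone (total l J) := by
  intro a b h
  have := Nat.div_le_div_right (c := l) h
  unfold total; omega

theorem total_add (hl : 1 ≤ l) (n : ℕ) : total l J (n + l) = total l J n + (l + 1) := by
  unfold total
  rw [Nat.add_div_right _ (by omega)]
  omega

theorem profile_eq_zero {n i : ℕ} (h : n < i) : profile l J n i = 0 := by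
  induction n generalizing i with
  | zero => simp [profile]; omega
  | succ n ih => simp [profile, ih (show n < i by omega), ih (show n < i - 1 by omega)]

/-- The differences obey the recursion of the profile with `J + 1` for `J` in the first coefficient
and the same `total`. At `i = 0` the truncated index `i - 1` is harmless, since its coefficient
vanishes. -/
theorem profile_succ_sub (n i : ℕ) :
    profile l J (n + 1) i - profile l J (n + 1) (i + 1) =
      (1 - (i + J + 2) / total l J n) * (profile l J n i - profile l J n (i + 1)) +
      i / total l J n * (profile l J n (i - 1) - profile l J n (i - 1 + 1)) := by
  have hT := (total_pos (l := l) (J := J) n).ne'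
  rcases i with _ | i
  · simp [profile]; field_simp; ring
  · simp [profile]; field_simp; ring

theorem profile_antitone (n : ℕ) : Antitone (profile l J n) := by
  refine antitone_nat_of_succ_le fun i => ?_
  induction n generalizing i with
  | zero => rcases i with _ | i <;> simp [profile]
  | succ n ih =>
    rw [← sub_nonneg, profile_succ_sub]
    have hT := total_pos (l := l) (J := J) n
    refine add_nonneg ?_ (mul_nonneg (by positivity) (sub_nonneg.2 (ih _)))
    rcases le_or_gt i n with h | h
    · refine mul_nonneg ?_ (sub_nonneg.2 (ih _))
      rw [sub_nonneg, div_le_one hT]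
      have := le_cast_total (l := l) (J := J) n
      have h' : (i : ℝ) ≤ n := by exact_mod_cast h
      linarith
    · simp [profile_eq_zero h, profile_eq_zero (show n < i + 1 by omega)]

theorem profile_nonneg (n i : ℕ) : 0 ≤ profile l J n i := by
  rcases le_or_gt i n with h | h
  · rw [← profile_eq_zero (l := l) (J := J) (Nat.lt_succ_self n)]
    exact profile_antitone n (by omega)
  · rw [profile_eq_zero h]

/-- No extra ball is present at any of the first `l` draws, so this is the classical Pólya urn with
one black ball: its profile is flat up to `n` and drops to zero there. -/
theorem profile_sub_of_le (n i : ℕ) (hn : n ≤ l) :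
    profile l J n i - profile l J n (i + 1) =
      if i = n then (n.factorial : ℝ) / ((J + 2).ascFactorial n : ℝ) else 0 := by
  induction n generalizing i with
  | zero => rcases i with _ | i <;> simp [profile]
  | succ n ih =>
    have hT : (total l J n : ℝ) = J + 2 + n := by
      unfold total; rw [Nat.div_eq_of_lt (by omega)]; push_cast; ring
    have hT0 := total_pos (l := l) (J := J) n
    have hA : ((J + 2).ascFactorial n : ℝ) ≠ 0 := by
      exact_mod_cast (Nat.ascFactorial_pos _ _).ne'
    rw [profile_succ_sub, ih _ (by omega), ih _ (by omega), Nat.ascFactorial_succ,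
      Nat.factorial_succ]
    push_cast
    rw [hT] at hT0 ⊢
    rcases i with _ | i
    · rcases n with _ | n
      · simp; field_simp; simp
      · simp
    · have e : ((i + 1 : ℕ) - 1 = n) ↔ (i = n) := by omega
      simp only [e, Nat.add_right_cancel_iff]
      by_cases h1 : i + 1 = n
      · have h2 : i ≠ n := by omega
        simp only [h1, h2, if_true, if_false]
        have : (n : ℝ) = i + 1 := by exact_mod_cast h1.symm
        rw [this] at hT0 ⊢
        field_simp
        ring
      · by_cases h2 : i = n
        · subst h2; simp; field_simp
        · simp [h1, h2]

theorem growth_succ (q n : ℕ) :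
    growth l J q (n + 1) = growth l J q n * (1 + (q : ℝ) / total l J n) := by
  simp [growth, Finset.prod_range_succ]

theorem growth_pos (q n : ℕ) : 0 < growth l J q n := by
  refine Finset.prod_pos fun i _ => ?_
  have := total_pos (l := l) (J := J) i
  positivity

/-- Both sides satisfy the same recursion in `m`. On the right, `growth` supplies the ratio `total m
/ total (m + l)`, and since `total (m + l) = total m + (l + 1)`, the coefficient `total m - (i - l +
J + 1)` equals `total (m + l) - (i + J + 2)`. The initial case is the Pólya urn after `l` draws. -/
theorem profile_add_sub (hl : 1 ≤ l) (m i : ℕ) :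
    profile l J (m + l) i - profile l J (m + l) (i + 1) =
      1 / (((J + 2).ascFactorial l : ℝ) * growth l J (l + 1) m) * (i.descFactorial l : ℝ) *
        profile l J m (i - l) := by
  induction m generalizing i with
  | zero =>
    rw [zero_add, profile_sub_of_le _ _ le_rfl]
    rcases lt_trichotomy i l with h | h | h
    · simp [h.ne, Nat.descFactorial_of_lt h]
    · subst h; simp [profile, growth, Nat.descFactorial_self]; ring
    · have : i - l ≠ 0 := by omega
      simp [h.ne', profile, this]
  | succ m ih =>
    have hT := total_pos (l := l) (J := J) m
    have hg := growth_pos (l := l) (J := J) (l + 1) m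
    have hA : (0 : ℝ) < ((J + 2).ascFactorial l : ℝ) := by
      exact_mod_cast (Nat.ascFactorial_pos _ _)
    rw [show m + 1 + l = (m + l) + 1 by ring, profile_succ_sub, ih, ih, total_add hl, growth_succ]
    rcases lt_or_ge i l with h | h
    · simp [Nat.descFactorial_of_lt h, Nat.descFactorial_of_lt (show i - 1 < l by omega)]
    · obtain ⟨k, rfl⟩ := Nat.exists_eq_add_of_le h
      have e1 : l + k - l = k := by omega
      have e2 : l + k - 1 - l = k - 1 := by omega
      -- With `i = l + k`, this matches the second coefficients of the two recursions.
      have hd : ((l + k : ℕ) : ℝ) * ((l + k - 1).descFactorial l : ℝ) =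
          k * ((l + k).descFactorial l : ℝ) := by
        have := Nat.succ_descFactorial (l + k - 1) l
        have e3 : l + k - 1 + 1 = l + k := by omega
        rw [e3, show l + k - l = k by omega] at this
        exact_mod_cast this.symm
      rw [e1, e2, profile]
      have hd' : ((l + k - 1).descFactorial l : ℝ) =
          k * ((l + k).descFactorial l : ℝ) / ((l + k : ℕ) : ℝ) := by
        rw [eq_div_iff (by positivity), ← hd]; ring
      rw [hd']
      have : (0 : ℝ) < (l : ℝ) + k := by
        have : (1 : ℝ) ≤ l := by exact_mod_cast hl
        positivity
      push_cast
      field_simp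
      ring

/-! ### Point masses and rising factorial moments. -/

theorem mass_nonneg (n i : ℕ) : 0 ≤ mass l J n i :=
  mul_nonneg (by positivity) (profile_nonneg n i)

theorem mass_eq_zero {n i : ℕ} (h : n < i) : mass l J n i = 0 := by
  simp [mass, profile_eq_zero h]

theorem mass_succ_zero (n : ℕ) :
    mass l J (n + 1) 0 = mass l J n 0 * (1 - (J + 1) / total l J n) := by
  simp [mass, profile]; ring

theorem mass_succ_succ (n i : ℕ) :
    mass l J (n + 1) (i + 1) =
      mass l J n (i + 1) * (1 - (((i + 1 : ℕ) : ℝ) + J + 1) / total l J n) +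
      mass l J n i * ((i + J + 1) / total l J n) := by
  have h : ((i : ℝ) + 1) * ((i + 2).ascFactorial J : ℝ) =
      (i + 1 + J) * ((i + 1).ascFactorial J : ℝ) := by
    exact_mod_cast Nat.succ_ascFactorial (i + 1) J
  have hT := (total_pos (l := l) (J := J) n).ne'
  have hJ : (J.factorial : ℝ) ≠ 0 := by positivity
  simp only [mass, profile, Nat.add_sub_cancel]
  push_cast
  field_simp
  linear_combination profile l J n i * h

/-- The Markov property: conditioning the expectation of `f` on the contents one draw earlier. -/
theorem sum_mass_succ (n : ℕ) (f : ℕ → ℝ) :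
    ∑ i ∈ Finset.range (n + 2), mass l J (n + 1) i * f i =
      ∑ i ∈ Finset.range (n + 1), mass l J n i *
        ((1 - (i + J + 1) / total l J n) * f i + (i + J + 1) / total l J n * f (i + 1)) := by
  rw [Finset.sum_range_succ']
  simp only [mass_succ_succ, mass_succ_zero, add_mul, mul_add, Finset.sum_add_distrib]
  have h := Finset.sum_range_succ' (fun i : ℕ => mass l J n i *
    ((1 - (i + J + 1) / total l J n) * f i)) (n + 1)
  rw [Finset.sum_range_succ, mass_eq_zero (Nat.lt_succ_self n)] at h
  simp only [zero_mul, add_zero] at h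
  rw [h]
  push_cast
  simp only [mul_assoc, zero_add]
  ring

theorem sum_mass (n : ℕ) : ∑ i ∈ Finset.range (n + 1), mass l J n i = 1 := by
  induction n with
  | zero => simp [mass, profile, Nat.one_ascFactorial,
      (Nat.cast_ne_zero (R := ℝ)).2 (Nat.factorial_ne_zero J)]
  | succ n ih =>
    have := sum_mass_succ (l := l) (J := J) n (fun _ => 1)
    simp only [mul_one, sub_add_cancel] at this
    rw [this, ih]

/-- Rising factorials are eigenfunctions of a draw: the one of order `q` at `w + 1`, times `w`, is
`w + q` times the one at `w`, so its conditional mean is multiplied by `1 + q / total`. -/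
theorem sum_mass_ascFactorial (q n : ℕ) :
    ∑ i ∈ Finset.range (n + 1), mass l J n i * ((i + J + 1).ascFactorial q : ℝ) =
      ((J + 1).ascFactorial q : ℝ) * growth l J q n := by
  induction n with
  | zero =>
    have hJ : (J.factorial : ℝ) ≠ 0 := by positivity
    simp [mass, profile, growth, Nat.one_ascFactorial, hJ]
  | succ n ih =>
    rw [sum_mass_succ, growth_succ, ← mul_assoc, ← ih, Finset.sum_mul]
    refine Finset.sum_congr rfl fun i _ => ?_
    have h : ((i : ℝ) + J + 1) * ((i + 1 + J + 1).ascFactorial q : ℝ) =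
        (i + J + 1 + q) * ((i + J + 1).ascFactorial q : ℝ) := by
      have := Nat.succ_ascFactorial (i + J + 1) q
      rw [show (i + J + 1).succ = i + 1 + J + 1 by simp; ring] at this
      exact_mod_cast this
    have hT := (total_pos (l := l) (J := J) n).ne'
    field_simp
    linear_combination mass l J n i * h

theorem sum_mass_le_one (n k : ℕ) : ∑ i ∈ Finset.range k, mass l J n i ≤ 1 := by
  rw [← sum_mass (l := l) (J := J) n]
  rcases le_total k (n + 1) with h | h
  · exact Finset.sum_le_sum_of_subset_of_nonneg (Finset.range_mono h) fun i _ _ => mass_nonneg n i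
  · rw [← Finset.sum_subset (Finset.range_mono h)]
    intro i _ hi
    exact mass_eq_zero (by simpa using hi)

/-! ### Size of the growth products. -/

theorem growth_mono (q : ℕ) : Monotone (growth l J q) := by
  refine monotone_nat_of_le_succ fun n => ?_
  rw [growth_succ]
  have := total_pos (l := l) (J := J) n
  exact le_mul_of_one_le_right (growth_pos q n).le
    (by linarith [show 0 ≤ (q : ℝ) / total l J n by positivity])

theorem growth_add_le (q n k : ℕ) :
    growth l J q (n + k) ≤ growth l J q n * (1 + (q : ℝ) / total l J n) ^ k := by
  induction k with
  | zero => simp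
  | succ k ih =>
    have h0 := total_pos (l := l) (J := J) n
    have h1 : (total l J n : ℝ) ≤ total l J (n + k) := by
      exact_mod_cast total_mono (Nat.le_add_right n k)
    rw [← add_assoc, growth_succ, pow_succ, ← mul_assoc]
    refine mul_le_mul ih ?_ (by positivity) ?_
    · gcongr
    · exact mul_nonneg (growth_pos q n).le (by positivity)

theorem growth_mul_le (p q n : ℕ) : growth l J (p * q) n ≤ growth l J p n ^ q := by
  rw [growth, growth, ← Finset.prod_pow]
  have hT := fun i => total_pos (l := l) (J := J) i
  refine Finset.prod_le_prod (fun i _ => ?_) fun i _ => ?_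
  · have := hT i; positivity
  · have := one_add_mul_le_pow (a := (p : ℝ) / total l J i) ?_ q
    · refine le_trans (le_of_eq ?_) this
      push_cast; ring
    · have := hT i
      linarith [show 0 ≤ (p : ℝ) / total l J i by positivity]

/-- Each factor `1 + (l + 1) / total i` equals `total (i + l) / total i`, so the product telescopes
and leaves only `l` factors at each end. -/
theorem growth_mul_prod (hl : 1 ≤ l) (n : ℕ) :
    growth l J (l + 1) n * ∏ s ∈ Finset.range l, (total l J s : ℝ) =
      ∏ s ∈ Finset.range l, (total l J (n + s) : ℝ) := by
  induction n with
  | zero => simp [growth]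
  | succ n ih =>
    have hT := total_pos (l := l) (J := J) n
    have key : (∏ s ∈ Finset.range l, (total l J (n + 1 + s) : ℝ)) * total l J n =
        (∏ s ∈ Finset.range l, (total l J (n + s) : ℝ)) * (total l J n + (l + 1)) := by
      have h1 := Finset.prod_range_succ (fun s => (total l J (n + s) : ℝ)) l
      have h2 := Finset.prod_range_succ' (fun s => (total l J (n + s) : ℝ)) l
      rw [h1, total_add hl, add_zero] at h2
      push_cast at h2
      rw [h2]
      congr 1
      exact Finset.prod_congr rfl fun s _ => by rw [show n + (s + 1) = n + 1 + s by ring]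
    rw [growth_succ, mul_right_comm, ih, ← mul_left_inj' hT.ne', key]
    push_cast
    field_simp

theorem exists_growth_bounds (hl : 1 ≤ l) (J : ℕ) : ∃ a A : ℝ, 0 < a ∧ 0 < A ∧ ∀ n : ℕ, 1 ≤ n →
    a * (n : ℝ) ^ l ≤ growth l J (l + 1) n ∧ growth l J (l + 1) n ≤ A * (n : ℝ) ^ l := by
  set P := ∏ s ∈ Finset.range l, (total l J s : ℝ)
  have hP : 0 < P := Finset.prod_pos fun s _ => total_pos s
  refine ⟨1 / P, (J + 2 * l + 4) ^ l / P, by positivity, by positivity, fun n hn => ?_⟩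
  have h : growth l J (l + 1) n = (∏ s ∈ Finset.range l, (total l J (n + s) : ℝ)) / P := by
    rw [eq_div_iff hP.ne']; exact growth_mul_prod hl n
  have hn' : (1 : ℝ) ≤ n := by exact_mod_cast hn
  rw [h, div_mul_eq_mul_div, div_mul_eq_mul_div, one_mul, ← mul_pow]
  have hc : ∀ x : ℝ, x ^ l = ∏ s ∈ Finset.range l, x := by simp
  rw [hc, hc]
  constructor
  · gcongr with s hs
    have := le_cast_total (l := l) (J := J) (n + s)
    push_cast at this
    have h' : (n : ℝ) ≤ total l J (n + s) := by
      linarith [(Nat.cast_nonneg s : (0 : ℝ) ≤ s), (Nat.cast_nonneg J : (0 : ℝ) ≤ J)]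
    exact_mod_cast h'
  · gcongr with s hs
    have hs' : s < l := by simpa using hs
    have h1 : total l J (n + s) ≤ J + 2 + 2 * (n + s) := by
      have := Nat.div_le_self (n + s) l
      unfold total; linarith
    have h2 : (total l J (n + s) : ℝ) ≤ J + 2 + 2 * (n + s) := by exact_mod_cast h1
    have h3 : (s : ℝ) ≤ l := by exact_mod_cast hs'.le
    refine h2.trans ?_
    have : 0 ≤ (J + 2 * l + 2 : ℝ) * (n - 1) := mul_nonneg (by positivity) (by linarith)
    nlinarith

/-! ### The scaling and its comparison with the growth product. -/

/-- The moment of order `l + 1` of the number of white balls after `n` draws. -/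
noncomputable def rawMoment (l J n : ℕ) : ℝ :=
  ∑ i ∈ Finset.range (n + 1), mass l J n i * ((i : ℝ) + J + 1) ^ (l + 1)

/-- The scaling of the number of white balls after `n` draws. -/
noncomputable def scale (l J n : ℕ) : ℝ :=
  (((l : ℝ) + 1) / ((J : ℝ) + 1) * rawMoment l J n) ^ (1 / ((l : ℝ) + 1))

theorem rawMoment_nonneg (n : ℕ) : 0 ≤ rawMoment l J n :=
  Finset.sum_nonneg fun i _ => mul_nonneg (mass_nonneg n i) (by positivity)

theorem scale_pow (n : ℕ) :
    scale l J n ^ (l + 1) = ((l : ℝ) + 1) / ((J : ℝ) + 1) * rawMoment l J n := by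
  have h := rawMoment_nonneg (l := l) (J := J) n
  rw [scale, ← Real.rpow_natCast, ← Real.rpow_mul (by positivity)]
  push_cast
  rw [one_div_mul_cancel (by positivity), Real.rpow_one]

theorem scale_nonneg (n : ℕ) : 0 ≤ scale l J n := by
  have h := rawMoment_nonneg (l := l) (J := J) n
  unfold scale; positivity

/-- Compares bases without taking roots of constants: as `K ≥ 1`, it may be replaced by its own
power. -/
theorem le_of_pow_succ_le {a b K : ℝ} (k : ℕ) (hb : 0 ≤ b) (hK : 1 ≤ K)
    (h : a ^ (k + 1) ≤ K * b ^ (k + 1)) : a ≤ K * b := by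
  refine le_of_pow_le_pow_left₀ (Nat.succ_ne_zero k) (by positivity) (h.trans ?_)
  rw [mul_pow]
  gcongr
  exact le_self_pow₀ hK (Nat.succ_ne_zero k)

theorem one_le_scale (n : ℕ) : 1 ≤ scale l J n := by
  have h1 : ((J : ℝ) + 1) ^ (l + 1) ≤ rawMoment l J n := by
    have h : ((J : ℝ) + 1) ^ (l + 1) =
        ∑ i ∈ Finset.range (n + 1), mass l J n i * ((J : ℝ) + 1) ^ (l + 1) := by
      rw [← Finset.sum_mul, sum_mass, one_mul]
    rw [h]
    refine Finset.sum_le_sum fun i _ => mul_le_mul_of_nonneg_left ?_ (mass_nonneg n i)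
    exact pow_le_pow_left₀ (by positivity) (by linarith [(Nat.cast_nonneg i : (0 : ℝ) ≤ i)]) _
  refine le_of_pow_le_pow_left₀ (Nat.succ_ne_zero l) (scale_nonneg n) ?_
  rw [one_pow, scale_pow]
  calc (1 : ℝ) ≤ ((l : ℝ) + 1) * ((J : ℝ) + 1) ^ l := by
        have := one_le_pow₀ (n := l) (show (1 : ℝ) ≤ (J : ℝ) + 1 by simp)
        nlinarith [(Nat.cast_nonneg l : (0 : ℝ) ≤ l)]
    _ = ((l : ℝ) + 1) / ((J : ℝ) + 1) * ((J : ℝ) + 1) ^ (l + 1) := by field_simp; ring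
    _ ≤ _ := by gcongr

theorem scale_pos (n : ℕ) : 0 < scale l J n := zero_lt_one.trans_le (one_le_scale n)

theorem rawMoment_le (n : ℕ) :
    rawMoment l J n ≤ ((J + 1).ascFactorial (l + 1) : ℝ) * growth l J (l + 1) n := by
  rw [← sum_mass_ascFactorial]
  refine Finset.sum_le_sum fun i _ => mul_le_mul_of_nonneg_left ?_ (mass_nonneg n i)
  exact_mod_cast Nat.pow_succ_le_ascFactorial (i + J + 1) (l + 1)

/-- For `w ≥ 1` the rising factorial of order `l + 1` lies between `w ^ (l + 1)` and `((l + 1) * w)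
^ (l + 1)`, so ordinary and rising moments are comparable. -/
theorem exists_scale_growth (l J : ℕ) : ∃ K : ℝ, 1 ≤ K ∧ ∀ n : ℕ,
    scale l J n ^ (l + 1) ≤ K * growth l J (l + 1) n ∧
    growth l J (l + 1) n ≤ K * scale l J n ^ (l + 1) := by
  set A : ℝ := ((J + 1).ascFactorial (l + 1) : ℝ)
  have hA : 0 < A := Nat.cast_pos.2 (Nat.ascFactorial_pos _ _)
  refine ⟨1 + ((l : ℝ) + 1) / ((J : ℝ) + 1) * A +
    ((l : ℝ) + 1) ^ (l + 1) * (((J : ℝ) + 1) / ((l : ℝ) + 1)) / A, ?_, fun n => ⟨?_, ?_⟩⟩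
  · have : 0 ≤ ((l : ℝ) + 1) / ((J : ℝ) + 1) * A +
      ((l : ℝ) + 1) ^ (l + 1) * (((J : ℝ) + 1) / ((l : ℝ) + 1)) / A := by positivity
    linarith
  · rw [scale_pow]
    have hg := growth_pos (l := l) (J := J) (l + 1) n
    calc _ ≤ ((l : ℝ) + 1) / ((J : ℝ) + 1) * (A * growth l J (l + 1) n) := by
          gcongr; exact rawMoment_le n
      _ = (((l : ℝ) + 1) / ((J : ℝ) + 1) * A) * growth l J (l + 1) n := by ring
      _ ≤ _ := by
          gcongr
          have : 0 ≤ ((l : ℝ) + 1) ^ (l + 1) * (((J : ℝ) + 1) / ((l : ℝ) + 1)) / A := by positivity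
          linarith
  · have h1 : A * growth l J (l + 1) n ≤ ((l : ℝ) + 1) ^ (l + 1) * rawMoment l J n := by
      rw [← sum_mass_ascFactorial, rawMoment, Finset.mul_sum]
      refine Finset.sum_le_sum fun i _ => ?_
      rw [mul_left_comm]
      refine mul_le_mul_of_nonneg_left ?_ (mass_nonneg n i)
      have h2 : ((i + J + 1).ascFactorial (l + 1) : ℝ) ≤ ((i + J + (l + 1) : ℕ) : ℝ) ^ (l + 1) := by
        exact_mod_cast Nat.ascFactorial_le_pow_add (i + J) (l + 1)
      refine h2.trans ?_
      rw [← mul_pow]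
      push_cast
      gcongr
      nlinarith [show (0 : ℝ) ≤ l * (i + J) by positivity]
    have h2 : rawMoment l J n = ((J : ℝ) + 1) / ((l : ℝ) + 1) * scale l J n ^ (l + 1) := by
      rw [scale_pow]; field_simp
    rw [h2, mul_comm A, ← le_div_iff₀ hA] at h1
    refine h1.trans ?_
    have hs := scale_pos (l := l) (J := J) n
    rw [← mul_assoc, mul_div_right_comm]
    gcongr
    have : 0 ≤ ((l : ℝ) + 1) / ((J : ℝ) + 1) * A := by positivity
    linarith

theorem exists_scale_le (l J k : ℕ) : ∃ K : ℝ, 1 ≤ K ∧ ∀ m n : ℕ, m ≤ n → n ≤ m + k →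
    scale l J n ≤ K * scale l J m ∧ scale l J m ≤ K * scale l J n ∧
    growth l J (l + 1) n ≤ K * growth l J (l + 1) m := by
  obtain ⟨K, hK, h⟩ := exists_scale_growth l J
  have hl : (1 : ℝ) ≤ (1 + ((l + 1 : ℕ) : ℝ)) ^ k :=
    one_le_pow₀ (by linarith [(Nat.cast_nonneg (l + 1) : (0 : ℝ) ≤ (l + 1 : ℕ))])
  set B := (1 + ((l + 1 : ℕ) : ℝ)) ^ k
  have hB : 1 ≤ K * K := by nlinarith
  refine ⟨K * K * B, by nlinarith, fun m n hmn hnm => ?_⟩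
  have h1 : growth l J (l + 1) n ≤ growth l J (l + 1) m * B := by
    refine (growth_mono (l + 1) hnm).trans ((growth_add_le (l + 1) m k).trans ?_)
    have hT := le_cast_total (l := l) (J := J) m
    have hT' : (1 : ℝ) ≤ total l J m := by
      linarith [(Nat.cast_nonneg m : (0 : ℝ) ≤ m), (Nat.cast_nonneg J : (0 : ℝ) ≤ J)]
    have hg := growth_pos (l := l) (J := J) (l + 1) m
    simp only [B]
    gcongr
    exact div_le_self (by positivity) hT'
  have h2 := growth_mono (l := l) (J := J) (l + 1) hmn
  have hm := h m
  have hn := h n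
  have hgm := growth_pos (l := l) (J := J) (l + 1) m
  have sm := scale_pos (l := l) (J := J) m
  have sn := scale_pos (l := l) (J := J) n
  refine ⟨le_of_pow_succ_le l sm.le (by nlinarith) ?_,
    le_of_pow_succ_le l sn.le (by nlinarith) ?_, ?_⟩
  · calc _ ≤ K * growth l J (l + 1) n := hn.1
      _ ≤ K * ((K * scale l J m ^ (l + 1)) * B) := by
          gcongr; exact h1.trans (by gcongr; exact hm.2)
      _ = _ := by ring
  · calc _ ≤ K * growth l J (l + 1) m := hm.1
      _ ≤ K * (K * scale l J n ^ (l + 1)) := by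
          gcongr; exact h2.trans hn.2
      _ = K * K * 1 * scale l J n ^ (l + 1) := by ring
      _ ≤ _ := by gcongr
  · refine h1.trans ?_
    calc _ = 1 * B * growth l J (l + 1) m := by ring
      _ ≤ _ := by gcongr

/-- A crude bound, sufficient to turn each `1 / total` produced by a draw into `O(1/μ)`. -/
theorem exists_scale_le_total (hl : 1 ≤ l) (J : ℕ) : ∃ K : ℝ, 1 ≤ K ∧ ∀ n : ℕ,
    scale l J n ≤ K * total l J n := by
  obtain ⟨K, hK, h⟩ := exists_scale_growth l J
  obtain ⟨a, A, ha, hA, hg⟩ := exists_growth_bounds hl J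
  refine ⟨K * (1 + A), by nlinarith, fun n => ?_⟩
  have hT := le_cast_total (l := l) (J := J) n
  have hJ := (Nat.cast_nonneg J : (0 : ℝ) ≤ J)
  have hn := (Nat.cast_nonneg n : (0 : ℝ) ≤ n)
  have hT1 : (1 : ℝ) ≤ total l J n := by linarith
  refine le_of_pow_succ_le l (by linarith) (by nlinarith) ((h n).1.trans ?_)
  rw [mul_assoc]
  gcongr
  rcases Nat.eq_zero_or_pos n with h0 | h0
  · subst h0
    have := one_le_pow₀ hT1 (n := l + 1)
    simp only [growth, Finset.range_zero, Finset.prod_empty]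
    nlinarith
  · refine (hg n h0).2.trans ?_
    calc _ ≤ A * (total l J n : ℝ) ^ (l + 1) := by
          gcongr
          calc (n : ℝ) ^ l ≤ (total l J n : ℝ) ^ l := pow_le_pow_left₀ hn (by linarith) l
            _ ≤ _ := pow_le_pow_right₀ hT1 (by omega)
      _ ≤ _ := by gcongr; linarith

/-! ### A priori decay of the profile. -/

/-- `profile n 0` is a product of factors `1 - (J + 1) x` with `x = 1 / total`. By `1 + t ≤ exp t`,
the product of `(1 - (J + 1) x) ^ (l + 1)` and `(1 + (l + 1) x) ^ (J + 1)` is at most one, the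
exponents cancelling. -/
theorem profile_zero_pow_mul_le (n : ℕ) :
    profile l J n 0 ^ (l + 1) * growth l J (l + 1) n ^ (J + 1) ≤ 1 := by
  induction n with
  | zero => simp [profile, growth]
  | succ n ih =>
    have hT := total_pos (l := l) (J := J) n
    have hT' := le_cast_total (l := l) (J := J) n
    have h0 : profile l J (n + 1) 0 = (1 - (J + 1) / total l J n) * profile l J n 0 := by
      simp [profile]
    have h1 : 0 ≤ 1 - ((J : ℝ) + 1) / total l J n := by
      rw [sub_nonneg, div_le_one hT]
      linarith [(Nat.cast_nonneg n : (0 : ℝ) ≤ n)]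
    set x : ℝ := 1 / total l J n
    have hx : 0 < x := by positivity
    have h2 : 1 - ((J : ℝ) + 1) / total l J n ≤ Real.exp (-((J + 1) * x)) := by
      have := Real.add_one_le_exp (-(((J : ℝ) + 1) * x))
      simp only [x] at this ⊢
      rw [mul_one_div] at this ⊢
      linarith
    have h3 : 1 + ((l + 1 : ℕ) : ℝ) / total l J n ≤ Real.exp ((l + 1) * x) := by
      have := Real.add_one_le_exp ((((l : ℝ) + 1) * x))
      simp only [x] at this ⊢
      rw [mul_one_div] at this ⊢
      push_cast
      linarith
    have h4 : (1 - ((J : ℝ) + 1) / total l J n) ^ (l + 1) *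
        (1 + ((l + 1 : ℕ) : ℝ) / total l J n) ^ (J + 1) ≤ 1 := by
      calc _ ≤ Real.exp (-((J + 1) * x)) ^ (l + 1) * Real.exp ((l + 1) * x) ^ (J + 1) := by gcongr
        _ = 1 := by
          rw [← Real.exp_nat_mul, ← Real.exp_nat_mul, ← Real.exp_add, Real.exp_eq_one_iff]
          push_cast; ring
    rw [h0, growth_succ, mul_pow, mul_pow]
    calc _ = ((1 - ((J : ℝ) + 1) / total l J n) ^ (l + 1) *
        (1 + ((l + 1 : ℕ) : ℝ) / total l J n) ^ (J + 1)) *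
        (profile l J n 0 ^ (l + 1) * growth l J (l + 1) n ^ (J + 1)) := by ring
      _ ≤ 1 * 1 := by
        refine mul_le_mul h4 ih ?_ zero_le_one
        exact mul_nonneg (pow_nonneg (profile_nonneg n 0) _) (pow_nonneg (growth_pos _ n).le _)
      _ = 1 := one_mul 1

theorem exists_profile_zero_le (l J : ℕ) : ∃ K : ℝ, 1 ≤ K ∧ ∀ n : ℕ,
    profile l J n 0 * scale l J n ^ (J + 1) ≤ K := by
  obtain ⟨K, hK, h⟩ := exists_scale_growth l J
  refine ⟨K ^ (J + 1), one_le_pow₀ hK, fun n => ?_⟩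
  have := le_of_pow_succ_le (a := profile l J n 0 * scale l J n ^ (J + 1)) (b := 1) l zero_le_one
    (one_le_pow₀ hK (n := J + 1)) ?_
  · simpa using this
  calc _ = profile l J n 0 ^ (l + 1) * (scale l J n ^ (l + 1)) ^ (J + 1) := by ring
    _ ≤ profile l J n 0 ^ (l + 1) * (K * growth l J (l + 1) n) ^ (J + 1) := by
        have := profile_nonneg (l := l) (J := J) n 0
        have := scale_pos (l := l) (J := J) n
        gcongr
        exact (h n).1
    _ = K ^ (J + 1) * (profile l J n 0 ^ (l + 1) * growth l J (l + 1) n ^ (J + 1)) := by ring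
    _ ≤ K ^ (J + 1) * 1 := by gcongr; exact profile_zero_pow_mul_le n
    _ = _ := by simp

theorem sum_ascFactorial (P k : ℕ) :
    (P + 1) * ∑ s ∈ Finset.range k, (s + 1).ascFactorial P = k.ascFactorial (P + 1) := by
  induction k with
  | zero => simp [Nat.zero_ascFactorial]
  | succ k ih =>
    have h := Nat.succ_ascFactorial k P
    rw [Finset.sum_range_succ, mul_add, ih, Nat.ascFactorial_succ, Nat.ascFactorial_succ]
    rw [Nat.succ_eq_add_one] at h
    linarith

/-- A Markov inequality sharpened by monotonicity: the profile at every `s ≤ i` is at least that at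
`i`, so the moment of order `q` dominates `profile n i` times a sum of rising factorials, of order
`i ^ (J + q + 1)`. -/
theorem profile_mul_pow_le (q n i : ℕ) : profile l J n i * ((i : ℝ) + 1) ^ (J + q + 1) ≤
    (J + q + 1) * J.factorial * ((J + 1).ascFactorial q : ℝ) * growth l J q n := by
  rcases lt_or_ge n i with hi | hi
  · rw [profile_eq_zero hi, zero_mul]
    have := growth_pos (l := l) (J := J) q n
    positivity
  have hJ : (0 : ℝ) < J.factorial := by positivity
  have h1 : profile l J n i / J.factorial *
      ∑ s ∈ Finset.range (i + 1), ((s + 1).ascFactorial (J + q) : ℝ) ≤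
      ((J + 1).ascFactorial q : ℝ) * growth l J q n := by
    rw [← sum_mass_ascFactorial, Finset.mul_sum]
    refine le_trans (Finset.sum_le_sum fun s hs => ?_)
      (Finset.sum_le_sum_of_subset_of_nonneg (Finset.range_mono (show i + 1 ≤ n + 1 by omega))
        fun s _ _ => mul_nonneg (mass_nonneg n s) (by positivity))
    have h2 : ((s + 1).ascFactorial (J + q) : ℝ) =
        ((s + 1).ascFactorial J : ℝ) * ((s + J + 1).ascFactorial q : ℝ) := by
      have := Nat.ascFactorial_mul_ascFactorial (s + 1) J q
      rw [show s + 1 + J = s + J + 1 by ring] at this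
      exact_mod_cast this.symm
    rw [h2, mass]
    have h3 : profile l J n i ≤ profile l J n s :=
      profile_antitone n (by simpa [Nat.lt_succ_iff] using hs)
    calc _ ≤ profile l J n s / J.factorial *
        (((s + 1).ascFactorial J : ℝ) * ((s + J + 1).ascFactorial q : ℝ)) := by gcongr
      _ = _ := by ring
  have h2 : ((i : ℝ) + 1) ^ (J + q + 1) ≤
      (J + q + 1) * ∑ s ∈ Finset.range (i + 1), ((s + 1).ascFactorial (J + q) : ℝ) := by
    have h3 := sum_ascFactorial (J + q) (i + 1)
    have h4 := Nat.pow_succ_le_ascFactorial (i + 1) (J + q + 1)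
    rw [← h3] at h4
    exact_mod_cast h4
  calc _ ≤ profile l J n i *
        ((J + q + 1) * ∑ s ∈ Finset.range (i + 1), ((s + 1).ascFactorial (J + q) : ℝ)) := by
        have := profile_nonneg (l := l) (J := J) n i
        gcongr
    _ = (J + q + 1) * J.factorial * (profile l J n i / J.factorial *
      ∑ s ∈ Finset.range (i + 1), ((s + 1).ascFactorial (J + q) : ℝ)) := by field_simp
    _ ≤ (J + q + 1) * J.factorial * (((J + 1).ascFactorial q : ℝ) * growth l J q n) := by gcongr
    _ = _ := by ring

/-- The value at zero controls indices up to the scale and the moment bound controls larger ones;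
convexity of the power combines the two. -/
theorem exists_profile_decay (l J q : ℕ) : ∃ C : ℝ, 1 ≤ C ∧ ∀ n i : ℕ,
    profile l J n i * (scale l J n + i) ^ (J + (l + 1) * q + 1) ≤
      C * scale l J n ^ ((l + 1) * q) := by
  obtain ⟨K, hK, h⟩ := exists_scale_growth l J
  obtain ⟨D, hD, h0⟩ := exists_profile_zero_le l J
  set N := J + (l + 1) * q + 1 with hN
  set E : ℝ := (J + ((l + 1) * q : ℕ) + 1) * J.factorial * ((J + 1).ascFactorial ((l + 1) * q) : ℝ)
  refine ⟨2 ^ (N - 1) * (D + E * K ^ q), ?_, fun n i => ?_⟩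
  · have h1 : (1 : ℝ) ≤ 2 ^ (N - 1) := one_le_pow₀ (by norm_num)
    have h2 : 0 ≤ E * K ^ q := by positivity
    nlinarith
  have hp := profile_nonneg (l := l) (J := J) n i
  have hs := scale_pos (l := l) (J := J) n
  have h1 : profile l J n i * (i : ℝ) ^ N ≤ E * K ^ q * scale l J n ^ ((l + 1) * q) := by
    calc _ ≤ profile l J n i * ((i : ℝ) + 1) ^ N := by gcongr; simp
      _ ≤ E * growth l J ((l + 1) * q) n := profile_mul_pow_le _ n i
      _ ≤ E * (growth l J (l + 1) n) ^ q := by gcongr; exact growth_mul_le _ _ _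
      _ ≤ E * (K * scale l J n ^ (l + 1)) ^ q := by
          have := growth_pos (l := l) (J := J) (l + 1) n
          gcongr
          exact (h n).2
      _ = _ := by rw [mul_pow, ← pow_mul]; ring
  have h2 : profile l J n i * scale l J n ^ N ≤ D * scale l J n ^ ((l + 1) * q) := by
    calc _ ≤ profile l J n 0 * scale l J n ^ N := by
          gcongr; exact profile_antitone n (Nat.zero_le i)
      _ = (profile l J n 0 * scale l J n ^ (J + 1)) * scale l J n ^ ((l + 1) * q) := by
          rw [hN]; ring
      _ ≤ _ := by gcongr; exact h0 n
  calc _ ≤ profile l J n i * (2 ^ (N - 1) * (scale l J n ^ N + (i : ℝ) ^ N)) := by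
        gcongr; exact add_pow_le hs.le (Nat.cast_nonneg i) N
    _ = 2 ^ (N - 1) * (profile l J n i * scale l J n ^ N + profile l J n i * (i : ℝ) ^ N) := by ring
    _ ≤ 2 ^ (N - 1) * (D * scale l J n ^ ((l + 1) * q) +
        E * K ^ q * scale l J n ^ ((l + 1) * q)) := by gcongr
    _ = _ := by ring

/-! ### Weighted bounds for the profile and its differences in space and time. -/

/-- The weight `1 + i / μ` that measures decay in the index `i` on the scale `μ`. -/
noncomputable def relSize (μ : ℝ) (i : ℕ) : ℝ := 1 + i / μ

theorem one_le_relSize {μ : ℝ} (hμ : 0 < μ) (i : ℕ) : 1 ≤ relSize μ i := by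
  have : 0 ≤ (i : ℝ) / μ := by positivity
  unfold relSize; linarith

theorem relSize_pos {μ : ℝ} (hμ : 0 < μ) (i : ℕ) : 0 < relSize μ i :=
  zero_lt_one.trans_le (one_le_relSize hμ i)

theorem mul_relSize {μ : ℝ} (hμ : 0 < μ) (i : ℕ) : μ * relSize μ i = μ + i := by
  unfold relSize; field_simp

theorem cast_le_mul_relSize {μ : ℝ} (hμ : 0 < μ) (i : ℕ) : (i : ℝ) ≤ μ * relSize μ i := by
  rw [mul_relSize hμ]; linarith

theorem relSize_le_sub {μ : ℝ} (hμ : 1 ≤ μ) (i k : ℕ) :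
    relSize μ i ≤ (1 + k) * relSize μ (i - k) := by
  have h1 : (i : ℝ) ≤ ((i - k : ℕ) : ℝ) + k := by exact_mod_cast (by omega : i ≤ i - k + k)
  have hμ0 : 0 < μ := by linarith
  have h2 : 0 ≤ ((i - k : ℕ) : ℝ) := Nat.cast_nonneg _
  have hk : (0 : ℝ) ≤ k := Nat.cast_nonneg _
  refine le_of_mul_le_mul_left ?_ hμ0
  rw [mul_left_comm, mul_relSize hμ0, mul_relSize hμ0]
  nlinarith

theorem relSize_mono {μ : ℝ} (hμ : 0 < μ) : Monotone (relSize μ) := by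
  intro a b h
  have : (a : ℝ) ≤ b := by exact_mod_cast h
  unfold relSize
  gcongr

/-- The decay bound expressed in the scale of a time up to `k` draws later, because the difference
identity links times `l` apart. -/
theorem exists_profile_le (l J k q : ℕ) : ∃ C : ℝ, 1 ≤ C ∧ ∀ m n i : ℕ, m ≤ n → n ≤ m + k →
    profile l J m i ≤ C / (scale l J n ^ (J + 1) * relSize (scale l J n) i ^ q) := by
  obtain ⟨C, hC, h⟩ := exists_profile_decay l J q
  obtain ⟨K, hK, hs⟩ := exists_scale_le l J k
  set N := J + (l + 1) * q + 1 with hN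
  refine ⟨K ^ N * C * K ^ ((l + 1) * q), ?_, fun m n i hmn hnm => ?_⟩
  · have h1 := one_le_pow₀ hK (n := N)
    have h2 := one_le_pow₀ hK (n := (l + 1) * q)
    have h3 : 1 ≤ K ^ N * C := by nlinarith
    nlinarith
  obtain ⟨s1, s2, -⟩ := hs m n hmn hnm
  have hp := profile_nonneg (l := l) (J := J) m i
  have hm := scale_pos (l := l) (J := J) m
  have hn := scale_pos (l := l) (J := J) n
  have hX := relSize_pos hn i
  have hX1 := one_le_relSize hn i
  have h1 : profile l J m i * (scale l J n + i) ^ N ≤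
      K ^ N * C * K ^ ((l + 1) * q) * scale l J n ^ ((l + 1) * q) := by
    calc _ ≤ profile l J m i * (K * (scale l J m + i)) ^ N := by
          gcongr
          have := (Nat.cast_nonneg i : (0 : ℝ) ≤ i)
          nlinarith
      _ = K ^ N * (profile l J m i * (scale l J m + i) ^ N) := by rw [mul_pow]; ring
      _ ≤ K ^ N * (C * (K * scale l J n) ^ ((l + 1) * q)) := by
          exact mul_le_mul_of_nonneg_left ((h m i).trans (by gcongr)) (by positivity)
      _ = _ := by rw [mul_pow]; ring
  rw [← mul_relSize hn, mul_pow] at h1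
  have h2 : scale l J n ^ N = scale l J n ^ (J + 1) * scale l J n ^ ((l + 1) * q) := by
    rw [hN]; ring
  rw [h2] at h1
  have h3 : 0 < scale l J n ^ ((l + 1) * q) := by positivity
  rw [le_div_iff₀ (by positivity)]
  refine le_of_mul_le_mul_right ?_ h3
  refine le_trans ?_ h1
  have h4 : relSize (scale l J n) i ^ q ≤ relSize (scale l J n) i ^ N :=
    pow_le_pow_right₀ hX1 (by rw [hN]; nlinarith)
  calc _ = profile l J m i * (scale l J n ^ (J + 1) * scale l J n ^ ((l + 1) * q) *
        relSize (scale l J n) i ^ q) := by ring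
    _ ≤ _ := by gcongr

/-- By the difference identity, a step in space costs a factor `O(relSize ^ l / μ)`; the `l` powers
of `relSize` are absorbed by asking for decay of order `q + l`. -/
theorem exists_profile_sub_le (hl : 1 ≤ l) (J k q : ℕ) : ∃ C : ℝ, 1 ≤ C ∧ ∀ m n i : ℕ,
    l ≤ m → m ≤ n → n ≤ m + k → profile l J m i - profile l J m (i + 1) ≤
      C / (scale l J n ^ (J + 2) * relSize (scale l J n) i ^ q) := by
  obtain ⟨C, hC, h⟩ := exists_profile_le l J (k + l) (q + l)
  obtain ⟨K, hK, hs⟩ := exists_scale_le l J (k + l)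
  obtain ⟨G, hG, hg⟩ := exists_scale_growth l J
  set S : ℝ := (1 + l) ^ (q + l)
  refine ⟨K * G * C * S, ?_, fun m n i hlm hmn hnm => ?_⟩
  · have h1 : 1 ≤ S := one_le_pow₀ (by simp)
    have h2 : 1 ≤ K * G := by nlinarith
    have h3 : 1 ≤ K * G * C := by nlinarith
    nlinarith
  obtain ⟨p, rfl⟩ := Nat.exists_eq_add_of_le' hlm
  have hμ := scale_pos (l := l) (J := J) n
  have hμ1 := one_le_scale (l := l) (J := J) n
  set μ := scale l J n
  have hgp := growth_pos (l := l) (J := J) (l + 1) p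
  have hX := relSize_pos hμ i
  rw [profile_add_sub hl]
  have h1 : 1 / (((J + 2).ascFactorial l : ℝ) * growth l J (l + 1) p) ≤ K * G / μ ^ (l + 1) := by
    have hA : (1 : ℝ) ≤ ((J + 2).ascFactorial l : ℝ) := by
      exact_mod_cast Nat.ascFactorial_pos _ _
    rw [div_le_div_iff₀ (by positivity) (by positivity), one_mul]
    calc _ ≤ G * growth l J (l + 1) n := (hg n).1
      _ ≤ G * (K * growth l J (l + 1) p) := by
          gcongr; exact (hs p n (by omega) (by omega)).2.2
      _ = K * G * (1 * growth l J (l + 1) p) := by ring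
      _ ≤ _ := by gcongr
  have h2 : (i.descFactorial l : ℝ) ≤ (μ * relSize μ i) ^ l := by
    refine le_trans ?_ (pow_le_pow_left₀ (Nat.cast_nonneg i) (cast_le_mul_relSize hμ i) l)
    exact_mod_cast Nat.descFactorial_le_pow i l
  have h3 : profile l J p (i - l) ≤ C * S / (μ ^ (J + 1) * relSize μ i ^ (q + l)) := by
    refine (h p n (i - l) (by omega) (by omega)).trans ?_
    have hX' := relSize_pos hμ (i - l)
    rw [div_le_div_iff₀ (by positivity) (by positivity)]
    have h4 := pow_le_pow_left₀ hX.le (relSize_le_sub hμ1 i l) (q + l)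
    rw [mul_pow] at h4
    calc _ = C * μ ^ (J + 1) * relSize μ i ^ (q + l) := by ring
      _ ≤ C * μ ^ (J + 1) * (S * relSize μ (i - l) ^ (q + l)) := by gcongr
      _ = _ := by ring
  calc _ ≤ K * G / μ ^ (l + 1) * (μ * relSize μ i) ^ l *
        (C * S / (μ ^ (J + 1) * relSize μ i ^ (q + l))) := by
        have := profile_nonneg (l := l) (J := J) p (i - l)
        gcongr
    _ = _ := by
        rw [mul_pow]; field_simp; ring

/-- One draw changes the profile by `1 / total` times `i` spatial differences and `J + 1` profile
values. These are of equal order, so a step in time also gains a factor `1/μ`. -/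
theorem exists_profile_succ_sub_le (hl : 1 ≤ l) (J k q : ℕ) : ∃ C : ℝ, 1 ≤ C ∧ ∀ m n i : ℕ,
    l ≤ m → m ≤ n → n ≤ m + k → |profile l J (m + 1) i - profile l J m i| ≤
      C / (scale l J n ^ (J + 2) * relSize (scale l J n) i ^ q) := by
  obtain ⟨C, hC, h⟩ := exists_profile_le l J k q
  obtain ⟨D, hD, hd⟩ := exists_profile_sub_le hl J k (q + 1)
  obtain ⟨K, hK, hs⟩ := exists_scale_le l J k
  obtain ⟨G, hG, hg⟩ := exists_scale_le_total hl J
  refine ⟨K * G * (D * 2 ^ (q + 1) + (J + 1) * C), ?_, fun m n i hlm hmn hnm => ?_⟩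
  · have h1 : (1 : ℝ) ≤ 2 ^ (q + 1) := one_le_pow₀ (by norm_num)
    have h2 : 1 ≤ K * G := by nlinarith
    have h3 : 0 ≤ ((J : ℝ) + 1) * C := by positivity
    have h4 : 1 ≤ D * 2 ^ (q + 1) := by nlinarith
    nlinarith
  have hμ := scale_pos (l := l) (J := J) n
  have hμ1 := one_le_scale (l := l) (J := J) n
  have hT := total_pos (l := l) (J := J) m
  have h1 : 1 / (total l J m : ℝ) ≤ K * G / scale l J n := by
    rw [div_le_div_iff₀ hT hμ, one_mul]
    calc _ ≤ K * scale l J m := (hs m n hmn hnm).1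
      _ ≤ K * (G * total l J m) := by gcongr; exact hg m
      _ = _ := by ring
  set μ := scale l J n
  have hX := relSize_pos hμ i
  have h2 : profile l J (m + 1) i - profile l J m i = 1 / (total l J m : ℝ) *
      (i * (profile l J m (i - 1) - profile l J m i) - (J + 1) * profile l J m i) := by
    simp only [profile]; field_simp; ring
  have h3 : 0 ≤ (i : ℝ) * (profile l J m (i - 1) - profile l J m i) :=
    mul_nonneg (Nat.cast_nonneg i) (sub_nonneg.2 (profile_antitone m (by omega)))
  have h4 : (i : ℝ) * (profile l J m (i - 1) - profile l J m i) ≤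
      D * 2 ^ (q + 1) / (μ ^ (J + 1) * relSize μ i ^ q) := by
    rcases i with _ | i
    · simp only [Nat.cast_zero, zero_mul]; positivity
    · have hX' := relSize_pos hμ i
      have h5 : relSize μ (i + 1) ≤ 2 * relSize μ i := by
        have := relSize_le_sub hμ1 (i + 1) 1
        norm_num at this
        exact this
      calc _ ≤ (μ * relSize μ (i + 1)) * (D / (μ ^ (J + 2) * relSize μ i ^ (q + 1))) := by
            refine mul_le_mul (cast_le_mul_relSize hμ _) (hd m n i hlm hmn hnm) ?_ (by positivity)
            exact sub_nonneg.2 (profile_antitone m (by omega))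
        _ ≤ (μ * relSize μ (i + 1)) * (D / (μ ^ (J + 2) * (relSize μ (i + 1) / 2) ^ (q + 1))) := by
            gcongr
            linarith
        _ = _ := by rw [div_pow]; field_simp; ring
  have h5 := h m n i hmn hnm
  have hp := profile_nonneg (l := l) (J := J) m i
  rw [h2, abs_mul, abs_of_pos (by positivity)]
  calc _ ≤ K * G / μ * (D * 2 ^ (q + 1) / (μ ^ (J + 1) * relSize μ i ^ q) +
        (J + 1) * (C / (μ ^ (J + 1) * relSize μ i ^ q))) := by
        gcongr
        rw [abs_le]
        constructor
        · have : ((J : ℝ) + 1) * profile l J m i ≤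
            (J + 1) * (C / (μ ^ (J + 1) * relSize μ i ^ q)) := by gcongr
          have : 0 ≤ D * 2 ^ (q + 1) / (μ ^ (J + 1) * relSize μ i ^ q) := by positivity
          linarith
        · have : 0 ≤ ((J : ℝ) + 1) * profile l J m i := by positivity
          have : 0 ≤ (J + 1) * (C / (μ ^ (J + 1) * relSize μ i ^ q)) := by positivity
          linarith
    _ = _ := by field_simp; ring

/-- The profile at `(m, i - l)` in the difference identity may be replaced by the one at `(m + l, i
+ 1)`: move `l` steps in time, then at most `l + 1` in space. This makes the identity a one-step
recursion at a fixed time. -/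
theorem exists_profile_shift_le (hl : 1 ≤ l) (J q : ℕ) : ∃ C : ℝ, 1 ≤ C ∧ ∀ m i : ℕ, l ≤ m →
    |profile l J m (i - l) - profile l J (m + l) (i + 1)| ≤
      C / (scale l J (m + l) ^ (J + 2) * relSize (scale l J (m + l)) i ^ q) := by
  obtain ⟨C, hC, h⟩ := exists_profile_succ_sub_le hl J l q
  obtain ⟨D, hD, hd⟩ := exists_profile_sub_le hl J 0 q
  refine ⟨(l * C + (l + 1) * D) * (1 + l) ^ q, ?_, fun m i hm => ?_⟩
  · have h1 : (1 : ℝ) ≤ (1 + l) ^ q := one_le_pow₀ (by simp)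
    have h2 : (1 : ℝ) ≤ l * C + (l + 1) * D := by
      have : (1 : ℝ) ≤ l := by exact_mod_cast hl
      nlinarith
    nlinarith
  have hμ := scale_pos (l := l) (J := J) (m + l)
  have hμ1 := one_le_scale (l := l) (J := J) (m + l)
  set μ := scale l J (m + l)
  have hX := relSize_pos hμ (i - l)
  have hX' := relSize_pos hμ i
  have h1 : |profile l J m (i - l) - profile l J (m + l) (i - l)| ≤
      l * (C / (μ ^ (J + 2) * relSize μ (i - l) ^ q)) := by
    rw [abs_sub_comm]
    have := Finset.sum_range_sub (fun k => profile l J (m + k) (i - l)) l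
    simp only [add_zero] at this
    rw [← this]
    refine (Finset.abs_sum_le_sum_abs _ _).trans ((Finset.sum_le_card_nsmul _ _
      (C / (μ ^ (J + 2) * relSize μ (i - l) ^ q)) fun k hk => ?_).trans (by simp))
    have hk' := Finset.mem_range.1 hk
    exact h (m + k) (m + l) (i - l) (by omega) (by omega) (by omega)
  have h2 : profile l J (m + l) (i - l) - profile l J (m + l) (i + 1) ≤
      (l + 1) * (D / (μ ^ (J + 2) * relSize μ (i - l) ^ q)) := by
    -- For `i < l` the truncated `i - l` makes the left index exceed `i + 1`; monotonicity covers
    -- that case too.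
    have h3 : profile l J (m + l) (i - l + (l + 1)) ≤ profile l J (m + l) (i + 1) :=
      profile_antitone _ (by omega)
    have := Finset.sum_range_sub' (fun k => profile l J (m + l) (i - l + k)) (l + 1)
    simp only [add_zero] at this
    refine (sub_le_sub_left h3 _).trans ?_
    rw [← this]
    refine (Finset.sum_le_card_nsmul _ _
      (D / (μ ^ (J + 2) * relSize μ (i - l) ^ q)) fun k hk => ?_).trans (by simp)
    refine (hd (m + l) (m + l) (i - l + k) (by omega) (by omega) (by omega)).trans ?_
    have := relSize_mono hμ (show i - l ≤ i - l + k by omega)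
    gcongr
  have h3 : 0 ≤ profile l J (m + l) (i - l) - profile l J (m + l) (i + 1) :=
    sub_nonneg.2 (profile_antitone _ (by omega))
  calc _ ≤ |profile l J m (i - l) - profile l J (m + l) (i - l)| +
        |profile l J (m + l) (i - l) - profile l J (m + l) (i + 1)| := abs_sub_le _ _ _
    _ ≤ l * (C / (μ ^ (J + 2) * relSize μ (i - l) ^ q)) +
        (l + 1) * (D / (μ ^ (J + 2) * relSize μ (i - l) ^ q)) := by
        rw [abs_of_nonneg h3]; gcongr
    _ = (l * C + (l + 1) * D) / (μ ^ (J + 2) * relSize μ (i - l) ^ q) := by ring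
    _ ≤ _ := by
        have h4 := pow_le_pow_left₀ hX'.le (relSize_le_sub hμ1 i l) q
        rw [mul_pow] at h4
        rw [div_le_div_iff₀ (by positivity) (by positivity)]
        calc _ = (l * C + (l + 1) * D) * μ ^ (J + 2) * relSize μ i ^ q := by ring
          _ ≤ (l * C + (l + 1) * D) * μ ^ (J + 2) * ((1 + l) ^ q * relSize μ (i - l) ^ q) := by
              gcongr
          _ = _ := by ring

/-! ### Elementary inequalities for powers and exponentials. -/

theorem pow_sub_pow_le {x y : ℝ} (hx : 0 ≤ x) (hxy : x ≤ y) (n : ℕ) :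
    y ^ n - x ^ n ≤ n * y ^ (n - 1) * (y - x) := by
  induction n with
  | zero => simp
  | succ n ih =>
    have hy : 0 ≤ y := hx.trans hxy
    have h1 : x ^ n * (y - x) ≤ y ^ n * (y - x) :=
      mul_le_mul_of_nonneg_right (pow_le_pow_left₀ hx hxy n) (by linarith)
    have h2 : y * (y ^ n - x ^ n) ≤ y * (n * y ^ (n - 1) * (y - x)) :=
      mul_le_mul_of_nonneg_left ih hy
    have h3 : y * (n * y ^ (n - 1) * (y - x)) = n * y ^ n * (y - x) := by
      rcases n with _ | n
      · simp
      · simp only [Nat.add_sub_cancel]; ring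
    simp only [Nat.add_sub_cancel]
    push_cast
    rw [h3] at h2
    rw [pow_succ, pow_succ]
    linarith

theorem le_pow_sub_pow {x y : ℝ} (hx : 0 ≤ x) (hxy : x ≤ y) (n : ℕ) :
    n * x ^ (n - 1) * (y - x) ≤ y ^ n - x ^ n := by
  induction n with
  | zero => simp
  | succ n ih =>
    have hy : 0 ≤ y := hx.trans hxy
    have h1 : x * (y ^ n - x ^ n) ≤ y * (y ^ n - x ^ n) :=
      mul_le_mul_of_nonneg_right hxy (sub_nonneg.2 (pow_le_pow_left₀ hx hxy n))
    have h2 : x * (n * x ^ (n - 1) * (y - x)) ≤ x * (y ^ n - x ^ n) :=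
      mul_le_mul_of_nonneg_left ih hx
    have h3 : x * (n * x ^ (n - 1) * (y - x)) = n * x ^ n * (y - x) := by
      rcases n with _ | n
      · simp
      · simp only [Nat.add_sub_cancel]; ring
    simp only [Nat.add_sub_cancel]
    push_cast
    rw [h3] at h2
    rw [pow_succ, pow_succ]
    linarith

theorem exp_neg_pow_sub_le {x y : ℝ} (hx : 0 ≤ x) (hxy : x ≤ y) (l : ℕ) :
    Real.exp (-x ^ (l + 1)) - Real.exp (-y ^ (l + 1)) ≤
      (l + 1) * y ^ l * (y - x) * Real.exp (-x ^ (l + 1)) := by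
  have h1 := pow_sub_pow_le hx hxy (l + 1)
  simp only [Nat.add_sub_cancel] at h1
  push_cast at h1
  have h2 : Real.exp (-y ^ (l + 1)) =
      Real.exp (-(y ^ (l + 1) - x ^ (l + 1))) * Real.exp (-x ^ (l + 1)) := by
    rw [← Real.exp_add]; congr 1; ring
  have h3 := Real.add_one_le_exp (-(y ^ (l + 1) - x ^ (l + 1)))
  have h4 := Real.exp_pos (-x ^ (l + 1))
  rw [h2]
  nlinarith

theorem le_exp_neg_pow_sub {x y : ℝ} (hx : 0 ≤ x) (hxy : x ≤ y) (l : ℕ) :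
    (l + 1) * x ^ l * (y - x) * Real.exp (-y ^ (l + 1)) ≤
      Real.exp (-x ^ (l + 1)) - Real.exp (-y ^ (l + 1)) := by
  have h1 := le_pow_sub_pow hx hxy (l + 1)
  simp only [Nat.add_sub_cancel] at h1
  push_cast at h1
  have h2 : Real.exp (-x ^ (l + 1)) =
      Real.exp (y ^ (l + 1) - x ^ (l + 1)) * Real.exp (-y ^ (l + 1)) := by
    rw [← Real.exp_add]; congr 1; ring
  have h3 := Real.add_one_le_exp (y ^ (l + 1) - x ^ (l + 1))
  have h4 := Real.exp_pos (-y ^ (l + 1))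
  rw [h2]
  nlinarith

theorem one_add_pow_mul_exp_le {x : ℝ} (hx : 0 ≤ x) (l q : ℕ) :
    (1 + x) ^ q * Real.exp (-x ^ (l + 1)) ≤ q.factorial * Real.exp 2 := by
  have h1 := Real.pow_div_factorial_le_exp (1 + x) (by linarith) q
  rw [div_le_iff₀ (by positivity)] at h1
  have h2 : x ≤ 1 + x ^ (l + 1) := by
    rcases le_total x 1 with h | h
    · have : 0 ≤ x ^ (l + 1) := by positivity
      linarith
    · have : x ≤ x ^ (l + 1) := le_self_pow₀ h (Nat.succ_ne_zero l)
      linarith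
  calc _ ≤ Real.exp (1 + x) * q.factorial * Real.exp (-x ^ (l + 1)) := by gcongr
    _ = q.factorial * Real.exp (1 + x + -x ^ (l + 1)) := by rw [Real.exp_add (1 + x)]; ring
    _ ≤ _ := by gcongr; linarith

/-! ### Precise size of the moment and of the rate. -/

/-- Two errors of relative size `O(1/μ)` enter: the growth during `l` further draws, and the gap
between rising and ordinary powers. -/
theorem exists_abs_rawMoment_sub_le (hl : 1 ≤ l) (J : ℕ) : ∃ C : ℝ, 1 ≤ C ∧ ∀ m : ℕ,
    |rawMoment l J (m + l) - ((J + 1).ascFactorial (l + 1) : ℝ) * growth l J (l + 1) m| ≤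
      C * scale l J (m + l) ^ l := by
  obtain ⟨K, hK, hs⟩ := exists_scale_le l J l
  obtain ⟨G, hG, hg⟩ := exists_scale_le_total hl J
  obtain ⟨H, hH, hh⟩ := exists_scale_growth l J
  set A : ℝ := ((J + 1).ascFactorial (l + 1) : ℝ) with hAdef
  have hA : 1 ≤ A := by rw [hAdef]; exact_mod_cast Nat.ascFactorial_pos _ _
  set B : ℝ := l * (1 + ((l + 1 : ℕ) : ℝ)) ^ (l - 1) * ((l + 1 : ℕ) : ℝ)
  have hB : 0 ≤ B := by positivity
  set E : ℝ := ((l : ℝ) + 1) * (1 + l) ^ l * l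
  have hE : 0 ≤ E := by positivity
  set R : ℝ := 1 + ((J : ℝ) + 1) / ((l : ℝ) + 1)
  have hR : 1 ≤ R := by
    have : 0 ≤ ((J : ℝ) + 1) / ((l : ℝ) + 1) := by positivity
    linarith
  have hAH : 0 ≤ A * H * B * K * G := by positivity
  have hER : 0 ≤ E * R := by positivity
  refine ⟨A * H * B * K * G + E * R + 1, by linarith, fun m => ?_⟩
  have hμ := scale_pos (l := l) (J := J) (m + l)
  have hT := total_pos (l := l) (J := J) m
  have hTm : scale l J (m + l) ≤ K * G * total l J m := by
    refine (hs m (m + l) (by omega) le_rfl).1.trans ?_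
    rw [mul_assoc]
    exact mul_le_mul_of_nonneg_left (hg m) (by positivity)
  set μ := scale l J (m + l)
  have hgm := growth_pos (l := l) (J := J) (l + 1) m
  have h1 : A * growth l J (l + 1) (m + l) - A * growth l J (l + 1) m ≤
      A * H * B * K * G * μ ^ l := by
    have h2 := growth_add_le (l := l) (J := J) (l + 1) m l
    have hT1 : (1 : ℝ) ≤ total l J m := by
      have := le_cast_total (l := l) (J := J) m
      linarith [(Nat.cast_nonneg m : (0 : ℝ) ≤ m), (Nat.cast_nonneg J : (0 : ℝ) ≤ J)]
    set y := ((l + 1 : ℕ) : ℝ) / total l J m with hy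
    have hy0 : 0 ≤ y := by positivity
    have hy1 : y ≤ ((l + 1 : ℕ) : ℝ) := div_le_self (by positivity) hT1
    have h3 := pow_sub_pow_le zero_le_one (show (1 : ℝ) ≤ 1 + y by linarith) l
    rw [one_pow] at h3
    have h4 : (1 + y) ^ l - 1 ≤ B * (K * G / μ) := by
      refine h3.trans ?_
      calc _ = l * (1 + y) ^ (l - 1) * y := by ring
        _ ≤ l * (1 + ((l + 1 : ℕ) : ℝ)) ^ (l - 1) * (((l + 1 : ℕ) : ℝ) * (K * G / μ)) := by
            gcongr
            rw [hy, div_eq_mul_one_div]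
            refine mul_le_mul_of_nonneg_left ?_ (by positivity)
            rw [div_le_div_iff₀ hT hμ]
            linarith
        _ = _ := by simp only [B]; ring
    have h5 : growth l J (l + 1) m ≤ H * μ ^ (l + 1) :=
      (growth_mono _ (Nat.le_add_right m l)).trans (hh (m + l)).2
    calc _ ≤ A * (growth l J (l + 1) m * (1 + y) ^ l) - A * growth l J (l + 1) m := by gcongr
      _ = A * (growth l J (l + 1) m * ((1 + y) ^ l - 1)) := by ring
      _ ≤ A * ((H * μ ^ (l + 1)) * (B * (K * G / μ))) := by
          have : 0 ≤ B * (K * G / μ) := by positivity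
          have : 0 ≤ (1 + y) ^ l - 1 := sub_nonneg.2 (one_le_pow₀ (by linarith))
          gcongr
      _ = _ := by field_simp; ring
  have h2 : A * growth l J (l + 1) (m + l) - rawMoment l J (m + l) ≤ E * R * μ ^ l := by
    have h3 : ∀ i : ℕ, ((i + J + 1).ascFactorial (l + 1) : ℝ) - ((i : ℝ) + J + 1) ^ (l + 1) ≤
        E * (μ ^ l + ((i : ℝ) + J + 1) ^ (l + 1) / μ) := by
      intro i
      set W : ℝ := (i : ℝ) + J + 1
      have hW : 1 ≤ W := by
        simp only [W]
        linarith [(Nat.cast_nonneg i : (0 : ℝ) ≤ i), (Nat.cast_nonneg J : (0 : ℝ) ≤ J)]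
      have h4 : ((i + J + 1).ascFactorial (l + 1) : ℝ) ≤ (W + l) ^ (l + 1) := by
        have : ((i + J + 1).ascFactorial (l + 1) : ℝ) ≤ ((i + J + (l + 1) : ℕ) : ℝ) ^ (l + 1) := by
          exact_mod_cast Nat.ascFactorial_le_pow_add (i + J) (l + 1)
        refine this.trans (le_of_eq ?_)
        simp only [W]; push_cast; ring
      have h5 := pow_sub_pow_le (x := W) (y := W + l) (by linarith) (by simp) (l + 1)
      simp only [Nat.add_sub_cancel] at h5
      -- This avoids the moment of order `l`; only the one of order `l + 1` is needed, which is a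
      -- multiple of `μ ^ (l + 1)` by definition.
      have h6 : W ^ l ≤ μ ^ l + W ^ (l + 1) / μ := by
        rcases le_total W μ with h | h
        · have h7 : W ^ l ≤ μ ^ l := by gcongr
          have : 0 ≤ W ^ (l + 1) / μ := by positivity
          linarith
        · have : W ^ l ≤ W ^ (l + 1) / μ := by
            rw [le_div_iff₀ hμ, pow_succ]; gcongr
          have : 0 ≤ μ ^ l := by positivity
          linarith
      calc _ ≤ (W + l) ^ (l + 1) - W ^ (l + 1) := by gcongr
        _ ≤ _ := h5
        _ ≤ ((l + 1 : ℕ) : ℝ) * ((1 + l) * W) ^ l * l := by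
            have h8 : W + l ≤ (1 + l) * W := by nlinarith [(Nat.cast_nonneg l : (0 : ℝ) ≤ l)]
            rw [add_sub_cancel_left]
            gcongr
        _ = E * W ^ l := by rw [mul_pow]; simp only [E]; push_cast; ring
        _ ≤ _ := by gcongr
    rw [← sum_mass_ascFactorial, rawMoment, ← Finset.sum_sub_distrib]
    calc _ ≤ ∑ i ∈ Finset.range (m + l + 1), mass l J (m + l) i *
          (E * (μ ^ l + ((i : ℝ) + J + 1) ^ (l + 1) / μ)) := by
          refine Finset.sum_le_sum fun i _ => ?_
          rw [← mul_sub]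
          exact mul_le_mul_of_nonneg_left (h3 i) (mass_nonneg _ i)
      _ = E * (μ ^ l * ∑ i ∈ Finset.range (m + l + 1), mass l J (m + l) i +
            rawMoment l J (m + l) / μ) := by
          rw [rawMoment, Finset.sum_div, Finset.mul_sum, ← Finset.sum_add_distrib, Finset.mul_sum]
          refine Finset.sum_congr rfl fun i _ => ?_
          ring
      _ = _ := by
          have h5 : rawMoment l J (m + l) = ((J : ℝ) + 1) / ((l : ℝ) + 1) * μ ^ (l + 1) := by
            rw [scale_pow]; field_simp
          rw [sum_mass, h5]
          simp only [R]
          field_simp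
          ring
  have h3 := rawMoment_le (l := l) (J := J) (m + l)
  have h4 : A * growth l J (l + 1) m ≤ A * growth l J (l + 1) (m + l) := by
    gcongr; exact growth_mono _ (Nat.le_add_right m l)
  have h5 : 0 < μ ^ l := by positivity
  have h6 : 0 ≤ A * H * B * K * G * μ ^ l := by positivity
  have h7 : 0 ≤ E * R * μ ^ l := by positivity
  rw [abs_le]
  constructor <;> nlinarith

/-- The factor in the relation between the profiles after `m` and after `m + l` draws. -/
noncomputable def rate (l J m : ℕ) : ℝ :=
  1 / (((J + 2).ascFactorial l : ℝ) * growth l J (l + 1) m)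

theorem rate_pos (m : ℕ) : 0 < rate l J m := by
  have h1 : (0 : ℝ) < ((J + 2).ascFactorial l : ℝ) := Nat.cast_pos.2 (Nat.ascFactorial_pos _ _)
  have h2 := growth_pos (l := l) (J := J) (l + 1) m
  unfold rate; positivity

/-- The moment of order `l + 1` is close to `J + 1` divided by the rate, and `μ ^ (l + 1)` is `(l +
1) / (J + 1)` times that moment; hence the rate is close to `(l + 1) / μ ^ (l + 1)`. The cruder
lower bound with `κ` serves the weights in the Gronwall argument. -/
theorem exists_rate_bounds (hl : 1 ≤ l) (J : ℕ) : ∃ κ K : ℝ, 0 < κ ∧ 1 ≤ K ∧ ∀ m : ℕ,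
    κ / scale l J (m + l) ^ (l + 1) ≤ rate l J m ∧
    rate l J m ≤ K / scale l J (m + l) ^ (l + 1) ∧
    |rate l J m - (l + 1) / scale l J (m + l) ^ (l + 1)| ≤ K / scale l J (m + l) ^ (l + 2) := by
  obtain ⟨K, hK, hs⟩ := exists_scale_le l J l
  obtain ⟨H, hH, hh⟩ := exists_scale_growth l J
  obtain ⟨C, hC, hc⟩ := exists_abs_rawMoment_sub_le hl J
  have hA1 : (1 : ℝ) ≤ ((J + 2).ascFactorial l : ℝ) := by
    exact_mod_cast Nat.ascFactorial_pos _ _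
  set A : ℝ := ((J + 2).ascFactorial l : ℝ)
  have hAA : ((J + 1).ascFactorial (l + 1) : ℝ) = ((J : ℝ) + 1) * A := by
    have h1 := Nat.succ_ascFactorial (J + 1) l
    have h2 : (J + 1).ascFactorial (l + 1) = (J + 1) * (J + 2).ascFactorial l := by
      rw [Nat.ascFactorial_succ, ← h1]
    rw [h2]; push_cast; rfl
  refine ⟨1 / (A * H), H * K + H * K * C * (l + 1), by positivity, ?_, fun m => ?_⟩
  · have h1 : 1 ≤ H * K := by nlinarith
    have : 0 ≤ H * K * C * (l + 1) := by positivity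
    linarith
  have hμ := scale_pos (l := l) (J := J) (m + l)
  have h0 := hc m
  have hr := scale_pow (l := l) (J := J) (m + l)
  have hgm := growth_pos (l := l) (J := J) (l + 1) m
  have hg1 : growth l J (l + 1) m ≤ H * scale l J (m + l) ^ (l + 1) :=
    (growth_mono _ (Nat.le_add_right m l)).trans (hh (m + l)).2
  have hg2 : scale l J (m + l) ^ (l + 1) ≤ H * K * growth l J (l + 1) m := by
    refine (hh (m + l)).1.trans ?_
    rw [mul_assoc]
    gcongr
    exact (hs m (m + l) (by omega) le_rfl).2.2
  set μ := scale l J (m + l)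
  have hrate : rate l J m ≤ H * K / μ ^ (l + 1) := by
    rw [rate, div_le_div_iff₀ (by positivity) (by positivity), one_mul]
    refine hg2.trans ?_
    gcongr
    exact le_mul_of_one_le_left hgm.le hA1
  refine ⟨?_, ?_, ?_⟩
  · rw [rate, div_div]
    apply one_div_le_one_div_of_le (by positivity)
    rw [mul_assoc]
    gcongr
  · refine hrate.trans ?_
    gcongr
    have : 0 ≤ H * K * C * (l + 1) := by positivity
    linarith
  · have h1 : rawMoment l J (m + l) = ((J : ℝ) + 1) / (l + 1) * μ ^ (l + 1) := by
      rw [hr]; field_simp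
    rw [hAA, h1] at h0
    have h2 : rate l J m - (l + 1) / μ ^ (l + 1) = rate l J m * ((l + 1) / μ ^ (l + 1)) / (J + 1) *
        (((J : ℝ) + 1) / (l + 1) * μ ^ (l + 1) - (J + 1) * A * growth l J (l + 1) m) := by
      have hA0 : A ≠ 0 := by positivity
      rw [show rate l J m = 1 / (A * growth l J (l + 1) m) from rfl]; field_simp
    rw [h2, abs_mul, abs_of_pos (by have := rate_pos (l := l) (J := J) m; positivity)]
    calc _ ≤ H * K / μ ^ (l + 1) * ((l + 1) / μ ^ (l + 1)) / 1 * (C * μ ^ l) := by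
          gcongr
          simp
      _ = H * K * C * (l + 1) / μ ^ (l + 2) := by field_simp; ring
      _ ≤ _ := by
          gcongr
          have : 0 ≤ H * K := by positivity
          linarith

/-! ### The limiting shape as an approximate solution of the recursion. -/

/-- The limiting shape of the profile on the scale `μ`. -/
noncomputable def shape (l : ℕ) (μ : ℝ) (i : ℕ) : ℝ := Real.exp (-((i : ℝ) / μ) ^ (l + 1))

theorem shape_pos (μ : ℝ) (i : ℕ) : 0 < shape l μ i := Real.exp_pos _

theorem shape_le {μ : ℝ} (hμ : 0 < μ) (q i : ℕ) :
    shape l μ i ≤ q.factorial * Real.exp 2 / relSize μ i ^ q := by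
  have hX := relSize_pos hμ i
  rw [le_div_iff₀ (by positivity), mul_comm]
  exact one_add_pow_mul_exp_le (by positivity) l q

theorem shape_antitone {μ : ℝ} (hμ : 0 < μ) : Antitone (shape l μ) := by
  intro a b h
  have : (a : ℝ) ≤ b := by exact_mod_cast h
  unfold shape
  gcongr

theorem relSize_succ_le {μ : ℝ} (hμ : 1 ≤ μ) (i : ℕ) : relSize μ (i + 1) ≤ 2 * relSize μ i := by
  have := relSize_le_sub hμ (i + 1) 1
  norm_num at this
  exact this

/-- One Euler step of length `1/μ` for `u' = -(l + 1) x ^ l u`, implicit because the shape is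
evaluated at `i + 1`. -/
theorem exists_shape_step_le (hl : 1 ≤ l) (K : ℝ) (hK : 1 ≤ K) : ∃ C : ℝ, 1 ≤ C ∧
    ∀ (μ γ : ℝ) (i : ℕ), 1 ≤ μ → 0 ≤ γ → γ ≤ K / μ ^ (l + 1) →
      |γ - (l + 1) / μ ^ (l + 1)| ≤ K / μ ^ (l + 2) →
      |shape l μ i - shape l μ (i + 1) - γ * i.descFactorial l * shape l μ (i + 1)| ≤
        C * relSize μ i ^ (2 * l) / μ ^ 2 * shape l μ i := by
  -- `D` accounts for the coefficient (error of `γ`, and falling factorial against power), `E` for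
  -- replacing `y ^ l` by `x ^ l`, and `F` for replacing the shape at `i` by that at `i + 1`.
  set D : ℝ := K + (l + 1) * (l * l) with hD
  set E : ℝ := (l + 1) * (l * 2 ^ (l - 1)) with hE
  set F : ℝ := (l + 1) * ((l + 1) * 2 ^ l) with hF
  have hD1 : 1 ≤ D := by
    have : (0 : ℝ) ≤ (l + 1) * (l * l) := by positivity
    linarith
  have hE0 : 0 ≤ E := by positivity
  have hF0 : 0 ≤ F := by positivity
  refine ⟨D + E + F, by linarith, fun μ γ i hμ1 hγ hγK hγd => ?_⟩
  have hμ : 0 < μ := by linarith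
  have hX := one_le_relSize hμ i
  have hX0 := relSize_pos hμ i
  have hcast := cast_le_mul_relSize hμ i
  set X := relSize μ i with hXdef
  set x : ℝ := (i : ℝ) / μ with hx
  have hx0 : 0 ≤ x := by positivity
  have hxX : x ≤ X := by simp only [X, relSize]; linarith
  set y : ℝ := ((i + 1 : ℕ) : ℝ) / μ with hy
  have hyx : y - x = 1 / μ := by rw [hy, hx]; push_cast; ring
  have hxy : x ≤ y := by
    have : 0 < 1 / μ := by positivity
    linarith
  have hyX : y ≤ 2 * X := by
    have h1 := relSize_succ_le hμ1 i
    have h2 : relSize μ (i + 1) = 1 + y := rfl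
    linarith
  have hw0 : 0 < shape l μ i := shape_pos μ i
  have hw1 : 0 < shape l μ (i + 1) := shape_pos μ (i + 1)
  have hw : shape l μ (i + 1) ≤ shape l μ i := shape_antitone hμ (Nat.le_succ i)
  have hup : shape l μ i - shape l μ (i + 1) ≤ (l + 1) * y ^ l * (y - x) * shape l μ i :=
    exp_neg_pow_sub_le hx0 hxy l
  have hlo : (l + 1) * x ^ l * (y - x) * shape l μ (i + 1) ≤ shape l μ i - shape l μ (i + 1) :=
    le_exp_neg_pow_sub hx0 hxy l
  rw [hyx] at hup hlo
  have hd1 : (i.descFactorial l : ℝ) ≤ (i : ℝ) ^ l := by exact_mod_cast Nat.descFactorial_le_pow i l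
  have hd2 : (i : ℝ) ^ l - i.descFactorial l ≤ l * l * (μ * X) ^ l / μ := by
    have h1 : ((i + 1 - l : ℕ) : ℝ) ^ l ≤ i.descFactorial l := by
      exact_mod_cast Nat.pow_sub_le_descFactorial i l
    have h2 : ((i + 1 - l : ℕ) : ℝ) ≤ i := by exact_mod_cast (by omega : i + 1 - l ≤ i)
    have h3 := pow_sub_pow_le (Nat.cast_nonneg (i + 1 - l)) h2 l
    have h4 : (i : ℝ) - ((i + 1 - l : ℕ) : ℝ) ≤ l := by
      have : (i : ℝ) ≤ ((i + 1 - l : ℕ) : ℝ) + l := by exact_mod_cast (by omega : i ≤ i + 1 - l + l)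
      linarith
    calc _ ≤ (i : ℝ) ^ l - ((i + 1 - l : ℕ) : ℝ) ^ l := by linarith
      _ ≤ _ := h3
      _ ≤ l * (μ * X) ^ (l - 1) * l := by
          gcongr
      _ = l * l * (μ * X) ^ (l - 1) := by ring
      _ ≤ l * l * ((μ * X) ^ l / μ) := by
          gcongr
          rw [le_div_iff₀ hμ]
          have h5 : (μ * X) ^ l = (μ * X) ^ (l - 1) * (μ * X) := by
            rw [← pow_succ, Nat.sub_add_cancel hl]
          rw [h5]
          gcongr
          nlinarith
      _ = _ := by ring
  have hc : |γ * i.descFactorial l - (l + 1) * x ^ l * (1 / μ)| ≤ D * X ^ l / μ ^ 2 := by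
    have e : γ * i.descFactorial l - (l + 1) * x ^ l * (1 / μ) =
        (γ - (l + 1) / μ ^ (l + 1)) * i.descFactorial l -
          (l + 1) / μ ^ (l + 1) * ((i : ℝ) ^ l - i.descFactorial l) := by
      rw [hx, div_pow]; field_simp; ring
    rw [e]
    calc _ ≤ |(γ - (l + 1) / μ ^ (l + 1)) * i.descFactorial l| +
          |(l + 1) / μ ^ (l + 1) * ((i : ℝ) ^ l - i.descFactorial l)| := abs_sub _ _
      _ = |γ - (l + 1) / μ ^ (l + 1)| * i.descFactorial l +
          (l + 1) / μ ^ (l + 1) * ((i : ℝ) ^ l - i.descFactorial l) := by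
          rw [abs_mul, abs_mul, Nat.abs_cast,
            abs_of_nonneg (sub_nonneg.2 hd1),
            abs_of_nonneg (show 0 ≤ ((l : ℝ) + 1) / μ ^ (l + 1) by positivity)]
      _ ≤ K / μ ^ (l + 2) * (μ * X) ^ l +
          (l + 1) / μ ^ (l + 1) * (l * l * (μ * X) ^ l / μ) := by
          gcongr
          exact hd1.trans (by gcongr)
      _ = _ := by rw [hD, mul_pow]; field_simp; ring
  have hXl : X ^ l ≤ X ^ (2 * l) := pow_le_pow_right₀ hX (by omega)
  rw [abs_le] at hc ⊢
  have hS : 0 ≤ X ^ (2 * l) / μ ^ 2 * shape l μ i := by positivity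
  constructor
  · have h1 : (γ * i.descFactorial l - (l + 1) * x ^ l * (1 / μ)) * shape l μ (i + 1) ≤
        D * X ^ l / μ ^ 2 * shape l μ (i + 1) := by gcongr; exact hc.2
    have h2 : D * X ^ l / μ ^ 2 * shape l μ (i + 1) ≤ D * X ^ (2 * l) / μ ^ 2 * shape l μ i := by
      gcongr
    have h3 : (D + E + F) * X ^ (2 * l) / μ ^ 2 * shape l μ i =
      D * X ^ (2 * l) / μ ^ 2 * shape l μ i + (E + F) * (X ^ (2 * l) / μ ^ 2 * shape l μ i) := by
      ring
    have h4 : 0 ≤ (E + F) * (X ^ (2 * l) / μ ^ 2 * shape l μ i) := by positivity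
    linarith
  · have h1 : ((l + 1) * x ^ l * (1 / μ) - γ * i.descFactorial l) * shape l μ (i + 1) ≤
        D * X ^ (2 * l) / μ ^ 2 * shape l μ i := by
      calc _ ≤ D * X ^ l / μ ^ 2 * shape l μ (i + 1) := by gcongr; linarith
        _ ≤ _ := by gcongr
    have h2 : (l + 1) * (y ^ l - x ^ l) * (1 / μ) * shape l μ i ≤
        E * X ^ (2 * l) / μ ^ 2 * shape l μ i := by
      have h3 := pow_sub_pow_le hx0 hxy l
      rw [hyx] at h3
      calc _ ≤ (l + 1) * (l * (2 * X) ^ (l - 1) * (1 / μ)) * (1 / μ) * shape l μ i := by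
            gcongr
            refine h3.trans ?_
            have : 0 ≤ y := hx0.trans hxy
            gcongr
        _ = E * X ^ (l - 1) / μ ^ 2 * shape l μ i := by rw [hE, mul_pow]; field_simp
        _ ≤ _ := by
            gcongr
            omega
    have h3 : (l + 1) * x ^ l * (1 / μ) * (shape l μ i - shape l μ (i + 1)) ≤
        F * X ^ (2 * l) / μ ^ 2 * shape l μ i := by
      calc _ ≤ (l + 1) * X ^ l * (1 / μ) * ((l + 1) * (2 * X) ^ l * (1 / μ) * shape l μ i) := by
            gcongr
            refine hup.trans ?_
            have : 0 ≤ y := hx0.trans hxy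
            gcongr
        _ = _ := by rw [hF, mul_pow]; field_simp; ring
    have h4 : (D + E + F) * X ^ (2 * l) / μ ^ 2 * shape l μ i =
      D * X ^ (2 * l) / μ ^ 2 * shape l μ i +
      E * X ^ (2 * l) / μ ^ 2 * shape l μ i + F * X ^ (2 * l) / μ ^ 2 * shape l μ i := by ring
    rw [h4]
    linarith

/-! ### Comparison of profile and shape. -/

/-- A discrete Gronwall inequality: the damping `1 + c i` pays for the growth of the weight `B`. -/
theorem weighted_le_sum {d e c B : ℕ → ℝ} (hd : d 0 = 0) (hB : ∀ i, 0 ≤ B i)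
    (h : ∀ i, (1 + c i) * |d (i + 1)| ≤ |d i| + e i) (hBc : ∀ i, B (i + 1) ≤ (1 + c i) * B i)
    (i : ℕ) : B i * |d i| ≤ ∑ s ∈ Finset.range i, B s * e s := by
  induction i with
  | zero => simp [hd]
  | succ i ih =>
    rw [Finset.sum_range_succ]
    calc _ ≤ ((1 + c i) * B i) * |d (i + 1)| := by gcongr; exact hBc i
      _ = B i * ((1 + c i) * |d (i + 1)|) := by ring
      _ ≤ B i * (|d i| + e i) := mul_le_mul_of_nonneg_left (h i) (hB i)
      _ ≤ _ := by rw [mul_add]; gcongr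

/-- Consecutive values of `relSize` differ by `1/μ` and by a factor at most two, so each term is
dominated by a telescoping difference of reciprocals. -/
theorem sum_one_div_relSize_sq_le {μ : ℝ} (hμ : 1 ≤ μ) (k : ℕ) :
    ∑ s ∈ Finset.range k, 1 / relSize μ s ^ 2 ≤ 2 * μ := by
  have hμ0 : 0 < μ := by linarith
  have h : ∑ s ∈ Finset.range k, 1 / relSize μ s ^ 2 ≤ 2 * μ * (1 - 1 / relSize μ k) := by
    induction k with
    | zero => simp [relSize]
    | succ k ih =>
      rw [Finset.sum_range_succ]
      have h1 := relSize_pos hμ0 k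
      have h2 := relSize_pos hμ0 (k + 1)
      have h3 := relSize_succ_le hμ k
      have h4 : 1 / relSize μ k ^ 2 ≤ 2 * μ * (1 / relSize μ k - 1 / relSize μ (k + 1)) := by
        have e : 2 * μ * (1 / relSize μ k - 1 / relSize μ (k + 1)) =
            2 / (relSize μ k * relSize μ (k + 1)) := by
          have : μ * relSize μ (k + 1) = μ * relSize μ k + 1 := by
            rw [mul_relSize hμ0, mul_relSize hμ0]; push_cast; ring
          field_simp
          linear_combination this
        rw [e, div_le_div_iff₀ (by positivity) (by positivity)]
        nlinarith
      linarith
  refine h.trans ?_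
  have := relSize_pos hμ0 k
  have : 0 ≤ 1 / relSize μ k := by positivity
  nlinarith

/-- A step increases `relSize ^ p` by a relative amount `O(1/(μ * relSize))`, while the damping is
at least of order `relSize ^ l / μ` once `relSize` is large. Below the threshold `K` the maximum
keeps the weight constant. -/
theorem exists_relSize_growth (hl : 1 ≤ l) (p : ℕ) {κ : ℝ} (hκ : 0 < κ) : ∃ K : ℝ, 1 ≤ K ∧
    ∀ (μ γ : ℝ) (i : ℕ), 1 ≤ μ → κ / μ ^ (l + 1) ≤ γ →
      max (relSize μ (i + 1)) K ^ p ≤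
        (1 + γ * i.descFactorial l) * max (relSize μ i) K ^ p := by
  set Q : ℝ := p * 2 ^ (p - 1) * 4 ^ l / κ with hQ
  have hQ0 : 0 ≤ Q := by positivity
  -- The part `2 * l + 3` forces `i ≥ 2 * l` and keeps the falling factorial above `(μ * relSize /
  -- 4) ^ l`; `Q` makes the damping beat the growth of the weight. One unit is lost in passing from
  -- `i + 1` to `i`.
  refine ⟨2 * l + 3 + Q, by linarith [(Nat.cast_nonneg l : (0 : ℝ) ≤ l)], fun μ γ i hμ1 hγ => ?_⟩
  have hμ : 0 < μ := by linarith
  have hγ0 : 0 < γ := lt_of_lt_of_le (by positivity) hγ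
  have hl0 := (Nat.cast_nonneg l : (0 : ℝ) ≤ l)
  set K : ℝ := 2 * l + 3 + Q with hK
  have hX := relSize_pos hμ i
  have hXs : relSize μ (i + 1) = relSize μ i + 1 / μ := by
    simp only [relSize]; push_cast; ring
  have hμi : 1 / μ ≤ 1 := by rw [div_le_one hμ]; exact hμ1
  rcases le_total (relSize μ (i + 1)) K with h | h
  · have h1 : relSize μ i ≤ K := (relSize_mono hμ (Nat.le_succ i)).trans h
    rw [max_eq_right h, max_eq_right h1]
    have hK0 : 0 < K := by linarith
    exact le_mul_of_one_le_left (by positivity)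
      (by linarith [show 0 ≤ γ * i.descFactorial l by positivity])
  · rw [max_eq_left h]
    refine le_trans ?_ (mul_le_mul_of_nonneg_left
      (pow_le_pow_left₀ hX.le (le_max_left _ K) p) (by positivity))
    have hX1 : 2 * l + 2 + Q ≤ relSize μ i := by linarith
    set X := relSize μ i with hXdef
    set t : ℝ := 1 / (μ * X) with ht
    have ht0 : 0 < t := by positivity
    have ht1 : t ≤ 1 := by
      rw [ht, div_le_one (by positivity)]
      nlinarith
    have h1 : relSize μ (i + 1) = X * (1 + t) := by rw [hXs, ht]; field_simp
    have h2 := pow_sub_pow_le zero_le_one (show (1 : ℝ) ≤ 1 + t by linarith) p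
    rw [one_pow] at h2
    have h3 : (1 + t) ^ p ≤ 1 + p * 2 ^ (p - 1) * t := by
      have : (p : ℝ) * (1 + t) ^ (p - 1) * (1 + t - 1) ≤ p * 2 ^ (p - 1) * t := by
        rw [add_sub_cancel_left]
        gcongr
        linarith
      linarith
    have hi : (i : ℝ) = μ * (X - 1) := by
      have := mul_relSize hμ i
      rw [mul_sub, this]; ring
    have h4 : (μ * X / 4) ^ l ≤ i.descFactorial l := by
      have hil : 2 * l ≤ i := by
        have : (2 * l : ℝ) ≤ i := by rw [hi]; nlinarith
        exact_mod_cast this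
      have h5 : (i : ℝ) ≤ 2 * ((i + 1 - l : ℕ) : ℝ) := by
        exact_mod_cast (by omega : i ≤ 2 * (i + 1 - l))
      have h6 : μ * X / 4 ≤ ((i + 1 - l : ℕ) : ℝ) := by nlinarith
      refine (pow_le_pow_left₀ (by positivity) h6 l).trans ?_
      exact_mod_cast Nat.pow_sub_le_descFactorial i l
    have h5 : p * 2 ^ (p - 1) * t ≤ γ * i.descFactorial l := by
      have h6 : p * 2 ^ (p - 1) = Q * κ / 4 ^ l := by rw [hQ]; field_simp
      calc p * 2 ^ (p - 1) * t = Q * (κ / (4 ^ l * μ) * (1 / X)) := by rw [h6, ht]; field_simp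
        _ ≤ X * (κ / (4 ^ l * μ) * (1 / X)) := by gcongr; linarith
        _ = κ / (4 ^ l * μ) := by field_simp
        _ ≤ κ / (4 ^ l * μ) * X ^ l := le_mul_of_one_le_right (by positivity)
            (one_le_pow₀ (by linarith))
        _ = κ / μ ^ (l + 1) * (μ * X / 4) ^ l := by rw [div_pow, mul_pow]; field_simp; ring
        _ ≤ _ := by gcongr
    rw [h1, mul_pow, mul_comm]
    gcongr
    linarith

theorem exists_profile_sub_shape_le (hl : 1 ≤ l) (J p : ℕ) : ∃ C : ℝ, 1 ≤ C ∧ ∀ m i : ℕ, l ≤ m →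
    |profile l J (m + l) i - profile l J (m + l) 0 * shape l (scale l J (m + l)) i| ≤
      C / (scale l J (m + l) ^ (J + 2) * relSize (scale l J (m + l)) i ^ p) := by
  obtain ⟨κ, R, hκ, hR, hr⟩ := exists_rate_bounds hl J
  obtain ⟨K, hK, hg⟩ := exists_relSize_growth hl p hκ
  obtain ⟨S, hS, hs⟩ := exists_shape_step_le hl R hR
  -- The extra `l` compensates the factor `c s`; the two further powers make the weighted errors
  -- summable.
  obtain ⟨V, hV, hv⟩ := exists_profile_shift_le hl J (p + 2 + l)
  obtain ⟨U, hU, hu⟩ := exists_profile_zero_le l J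
  set Z : ℝ := (p + 2 + 2 * l).factorial * Real.exp 2 with hZ
  set E : ℝ := R * V + U * S * Z with hE
  have hZ0 : 0 < Z := by positivity
  refine ⟨1 + 2 * K ^ p * E, by linarith [show 0 ≤ 2 * K ^ p * E by positivity], fun m i hm => ?_⟩
  have hμ := scale_pos (l := l) (J := J) (m + l)
  have hμ1 := one_le_scale (l := l) (J := J) (m + l)
  obtain ⟨r1, r2, r3⟩ := hr m
  have hγ := rate_pos (l := l) (J := J) m
  set γ := rate l J m
  have hv' := fun s => hv m s hm
  have hu' := hu (m + l)
  have hid := fun s => profile_add_sub (J := J) hl m s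
  set μ := scale l J (m + l)
  have hu0 := profile_nonneg (l := l) (J := J) (m + l) 0
  have hs' := fun s => hs μ γ s hμ1 hγ.le r2 r3
  set d : ℕ → ℝ := fun i => profile l J (m + l) i - profile l J (m + l) 0 * shape l μ i with hd
  set B : ℕ → ℝ := fun i => max (relSize μ i) K ^ p with hB
  set c : ℕ → ℝ := fun i => γ * i.descFactorial l with hc
  set e : ℕ → ℝ := fun i => c i * |profile l J m (i - l) - profile l J (m + l) (i + 1)| +
    profile l J (m + l) 0 * |shape l μ i - shape l μ (i + 1) - c i * shape l μ (i + 1)| with he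
  have hc0 : ∀ i, 0 ≤ c i := fun i => by simp only [hc]; positivity
  have hstep : ∀ s, (1 + c s) * |d (s + 1)| ≤ |d s| + e s := by
    intro s
    have h1 : (1 + c s) * d (s + 1) = d s -
        (c s * (profile l J m (s - l) - profile l J (m + l) (s + 1)) - profile l J (m + l) 0 *
          (shape l μ s - shape l μ (s + 1) - c s * shape l μ (s + 1))) := by
      have h2 : profile l J (m + l) s - profile l J (m + l) (s + 1) = c s * profile l J m (s - l) :=
        hid s
      simp only [hd]
      linear_combination -h2
    rw [← abs_of_nonneg (show 0 ≤ 1 + c s by linarith [hc0 s]), ← abs_mul, h1]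
    refine (abs_sub _ _).trans (add_le_add le_rfl ((abs_sub _ _).trans ?_))
    rw [abs_mul (c s), abs_mul (profile l J (m + l) 0), abs_of_nonneg (hc0 s), abs_of_nonneg hu0]
  have hB0 : ∀ s, 0 ≤ B s := fun s => by
    have := relSize_pos hμ s
    have : 0 ≤ max (relSize μ s) K := le_max_of_le_left this.le
    simp only [hB]; positivity
  have hd0 : d 0 = 0 := by simp [hd, shape]
  have hmain := weighted_le_sum hd0 hB0 hstep (fun s => hg μ γ s hμ1 r1) i
  -- Each weighted error is `O(μ ^ -(J + 3))` with two spare powers of `relSize`; summing them costs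
  -- a factor `2 * μ`.
  have he' : ∀ s, B s * e s ≤ K ^ p * E / μ ^ (J + 3) * (1 / relSize μ s ^ 2) := by
    intro s
    have hX := relSize_pos hμ s
    have hX1 := one_le_relSize hμ s
    have hcs : c s ≤ R * relSize μ s ^ l / μ := by
      have h2 : (s.descFactorial l : ℝ) ≤ (μ * relSize μ s) ^ l := by
        refine le_trans ?_ (pow_le_pow_left₀ (Nat.cast_nonneg s) (cast_le_mul_relSize hμ s) l)
        exact_mod_cast Nat.descFactorial_le_pow s l
      calc c s ≤ R / μ ^ (l + 1) * (μ * relSize μ s) ^ l := by simp only [hc]; gcongr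
        _ = _ := by rw [mul_pow]; field_simp; ring
    have hu1 : profile l J (m + l) 0 ≤ U / μ ^ (J + 1) := by
      rw [le_div_iff₀ (by positivity)]; exact hu'
    have h1 : e s ≤ E / (μ ^ (J + 3) * relSize μ s ^ (p + 2)) := by
      calc e s ≤ R * relSize μ s ^ l / μ * (V / (μ ^ (J + 2) * relSize μ s ^ (p + 2 + l))) +
            U / μ ^ (J + 1) * (S * relSize μ s ^ (2 * l) / μ ^ 2 *
              (Z / relSize μ s ^ (p + 2 + 2 * l))) := by
            simp only [he]
            have hw := shape_le (l := l) hμ (p + 2 + 2 * l) s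
            have := hs' s
            gcongr
            · exact hv' s
            · refine (hs' s).trans ?_
              gcongr
        _ = _ := by rw [hE]; field_simp; ring
    have h2 : B s ≤ K ^ p * relSize μ s ^ p := by
      rw [← mul_pow]
      refine pow_le_pow_left₀ (le_max_of_le_left hX.le) (max_le ?_ ?_) p <;> nlinarith
    have he0 : 0 ≤ e s := by simp only [he]; have := hc0 s; positivity
    calc _ ≤ K ^ p * relSize μ s ^ p * (E / (μ ^ (J + 3) * relSize μ s ^ (p + 2))) := by gcongr
      _ = _ := by field_simp; ring
  have hX := relSize_pos hμ i
  have h1 : relSize μ i ^ p * |d i| ≤ 2 * K ^ p * E / μ ^ (J + 2) := by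
    calc _ ≤ B i * |d i| := by
          simp only [hB]
          gcongr
          exact le_max_left _ _
      _ ≤ _ := hmain
      _ ≤ ∑ s ∈ Finset.range i, K ^ p * E / μ ^ (J + 3) * (1 / relSize μ s ^ 2) :=
          Finset.sum_le_sum fun s _ => he' s
      _ = K ^ p * E / μ ^ (J + 3) * ∑ s ∈ Finset.range i, 1 / relSize μ s ^ 2 := by
          rw [Finset.mul_sum]
      _ ≤ K ^ p * E / μ ^ (J + 3) * (2 * μ) := by
          gcongr; exact sum_one_div_relSize_sq_le hμ1 i
      _ = _ := by field_simp; ring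
  rw [le_div_iff₀ (by positivity)]
  rw [le_div_iff₀ (by positivity)] at h1
  calc _ = relSize μ i ^ p * |d i| * μ ^ (J + 2) := by simp only [hd]; ring
    _ ≤ _ := h1
    _ ≤ _ := by linarith

/-! ### The generalized gamma distribution function. -/

/-- The unnormalized density of the generalized gamma distribution. -/
noncomputable def weight (l J : ℕ) (x : ℝ) : ℝ := x ^ J * Real.exp (-x ^ (l + 1))

/-- The total mass of the unnormalized density of the generalized gamma distribution. -/
noncomputable def weightMass (l J : ℕ) : ℝ :=
  Real.Gamma (((J : ℝ) + 1) / ((l : ℝ) + 1)) / ((l : ℝ) + 1)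

/-- The distribution function of the generalized gamma distribution. -/
noncomputable def limitCdf (l J : ℕ) (t : ℝ) : ℝ :=
  (genGamma ((J : ℝ) + 1) ((l : ℝ) + 1)).real (Set.Iic t)

theorem continuous_weight : Continuous (weight l J) := by
  unfold weight; fun_prop

theorem weightMass_pos (l J : ℕ) : 0 < weightMass l J :=
  div_pos (Real.Gamma_pos_of_pos (by positivity)) (by positivity)

theorem weight_le {x : ℝ} (hx : 0 ≤ x) : weight l J x ≤ J.factorial * Real.exp 2 := by
  refine le_trans ?_ (one_add_pow_mul_exp_le hx l J)
  unfold weight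
  gcongr
  linarith

instance isProbabilityMeasure_genGamma (l J : ℕ) :
    IsProbabilityMeasure (genGamma ((J : ℝ) + 1) ((l : ℝ) + 1)) := by
  have := isProbabilityMeasure_gammaMeasure
    (show 0 < ((J : ℝ) + 1) / ((l : ℝ) + 1) by positivity) one_pos
  unfold genGamma
  exact Measure.isProbabilityMeasure_map (by fun_prop)

theorem gammaMeasure_ae_nonneg (a r : ℝ) : ∀ᵐ x ∂(gammaMeasure a r), 0 ≤ x := by
  rw [ae_iff]
  have : {x : ℝ | ¬0 ≤ x} = Set.Iio 0 := by ext; simp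
  rw [this, gammaMeasure, withDensity_apply _ measurableSet_Iio]
  exact lintegral_gammaPDF_of_nonpos le_rfl

theorem limitCdf_of_neg {t : ℝ} (ht : t < 0) : limitCdf l J t = 0 := by
  rw [limitCdf, genGamma, map_measureReal_apply (by fun_prop) measurableSet_Iic, measureReal_def]
  have : gammaMeasure (((J : ℝ) + 1) / ((l : ℝ) + 1)) 1
      ((fun x : ℝ => x ^ (1 / ((l : ℝ) + 1))) ⁻¹' Set.Iic t) = 0 := by
    refine measure_mono_null ?_ (gammaMeasure_ae_nonneg _ _)
    intro x hx h0
    have h1 : 0 ≤ x ^ (1 / ((l : ℝ) + 1)) := Real.rpow_nonneg h0 _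
    exact absurd (show x ^ (1 / ((l : ℝ) + 1)) ≤ t from hx) (by linarith)
  rw [this, ENNReal.toReal_zero]

/-- Substitute `x ^ r` for the gamma variable, with `r = l + 1`: as `r * a = J + 1`, the Jacobian
and the power in the gamma density combine to `x ^ J`. -/
theorem limitCdf_of_nonneg {t : ℝ} (ht : 0 ≤ t) :
    limitCdf l J t = (weightMass l J)⁻¹ * ∫ x in (0 : ℝ)..t, weight l J x := by
  set r : ℝ := (l : ℝ) + 1 with hr
  have hr0 : 0 < r := by positivity
  set a : ℝ := ((J : ℝ) + 1) / r with ha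
  have ha0 : 0 < a := by positivity
  have := isProbabilityMeasure_gammaMeasure ha0 one_pos
  have h1 : limitCdf l J t = (gammaMeasure a 1).real (Set.Iic (t ^ r)) := by
    rw [limitCdf, genGamma, map_measureReal_apply (by fun_prop) measurableSet_Iic]
    refine measureReal_congr ?_
    filter_upwards [gammaMeasure_ae_nonneg a 1] with x hx
    refine propext ?_
    change x ^ (1 / r) ≤ t ↔ x ≤ t ^ r
    rw [one_div, Real.rpow_inv_le_iff_of_pos hx ht hr0]
  rw [h1, ← cdf_eq_real, cdf_gammaMeasure_eq_integral ha0 one_pos]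
  have h2 : ∫ x in Set.Iic (t ^ r), gammaPDFReal a 1 x =
      ∫ x in Set.Ioi 0, (Set.Iic (t ^ r)).indicator (gammaPDFReal a 1) x := by
    rw [setIntegral_indicator measurableSet_Iic, Set.Ioi_inter_Iic, ← integral_Icc_eq_integral_Ioc]
    refine setIntegral_eq_of_subset_of_forall_sdiff_eq_zero measurableSet_Iic
      (fun x hx => hx.2) fun x hx => ?_
    have hx0 : ¬ 0 ≤ x := fun h => hx.2 ⟨h, hx.1⟩
    simp [gammaPDFReal, hx0]
  rw [h2, ← integral_comp_rpow_Ioi_of_pos hr0, intervalIntegral.integral_of_le ht,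
    ← Set.Ioi_inter_Iic, ← setIntegral_indicator measurableSet_Iic, ← integral_const_mul]
  refine setIntegral_congr_fun measurableSet_Ioi fun x hx => ?_
  have hx0 : 0 < x := hx
  have hiff : x ^ r ≤ t ^ r ↔ x ≤ t := Real.rpow_le_rpow_iff hx0.le ht hr0
  by_cases hxt : x ≤ t
  · have hm : x ^ r ∈ Set.Iic (t ^ r) := hiff.2 hxt
    have hm' : x ∈ Set.Iic t := hxt
    simp only [Set.indicator_of_mem hm, Set.indicator_of_mem hm', smul_eq_mul]
    have hG : Real.Gamma a ≠ 0 := (Real.Gamma_pos_of_pos ha0).ne'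
    have hpow : x ^ (r - 1) * (x ^ r) ^ (a - 1) = x ^ J := by
      rw [← Real.rpow_mul hx0.le, ← Real.rpow_add hx0, ← Real.rpow_natCast]
      congr 1
      rw [ha]; field_simp; ring
    have hxr : x ^ r = x ^ (l + 1) := by
      rw [hr, ← Real.rpow_natCast]; push_cast; rfl
    rw [gammaPDFReal, if_pos (by positivity), weightMass, weight, ← hpow, ← hr, ← ha, ← hxr]
    simp only [Real.one_rpow, one_mul]
    field_simp
  · have hm : x ^ r ∉ Set.Iic (t ^ r) := fun h => hxt (hiff.1 h)
    have hm' : x ∉ Set.Iic t := hxt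
    simp [Set.indicator_of_notMem hm, Set.indicator_of_notMem hm']

theorem limitCdf_sub {s t : ℝ} (hs : 0 ≤ s) (hst : s ≤ t) :
    limitCdf l J t - limitCdf l J s = (weightMass l J)⁻¹ * ∫ x in s..t, weight l J x := by
  rw [limitCdf_of_nonneg hs, limitCdf_of_nonneg (hs.trans hst), ← mul_sub,
    intervalIntegral.integral_interval_sub_left] <;>
  exact continuous_weight.intervalIntegrable _ _

theorem limitCdf_nonneg (t : ℝ) : 0 ≤ limitCdf l J t := measureReal_nonneg

theorem limitCdf_le_one (t : ℝ) : limitCdf l J t ≤ 1 := measureReal_le_one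

theorem limitCdf_mono : Monotone (limitCdf l J) := fun _ _ h =>
  measureReal_mono (Set.Iic_subset_Iic.2 h)

theorem tendsto_limitCdf : Filter.Tendsto (limitCdf l J) Filter.atTop (nhds 1) := by
  have h : limitCdf l J = cdf (genGamma ((J : ℝ) + 1) ((l : ℝ) + 1)) := by
    funext t; rw [cdf_eq_real]; rfl
  rw [h]
  exact tendsto_cdf_atTop _

theorem limitCdf_sub_le {s t : ℝ} (hst : s ≤ t) : limitCdf l J t - limitCdf l J s ≤
    (weightMass l J)⁻¹ * (J.factorial * Real.exp 2) * (t - s) := by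
  have hZ := weightMass_pos l J
  have key : ∀ s t : ℝ, 0 ≤ s → s ≤ t → limitCdf l J t - limitCdf l J s ≤
      (weightMass l J)⁻¹ * (J.factorial * Real.exp 2) * (t - s) := by
    intro s t hs hst
    rw [limitCdf_sub hs hst, mul_assoc]
    gcongr
    have := intervalIntegral.integral_mono_on (μ := volume) hst
      (continuous_weight (l := l) (J := J).intervalIntegrable s t)
      (intervalIntegrable_const (c := (J.factorial : ℝ) * Real.exp 2))
      fun x hx => weight_le (hs.trans hx.1)
    refine this.trans (le_of_eq ?_)
    simp; ring
  rcases lt_or_ge s 0 with hs | hs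
  · rcases lt_or_ge t 0 with ht | ht
    · rw [limitCdf_of_neg hs, limitCdf_of_neg ht, sub_zero]
      have : 0 ≤ t - s := by linarith
      positivity
    · have h1 := key 0 t le_rfl ht
      have h2 : limitCdf l J 0 = 0 := by simp [limitCdf_of_nonneg le_rfl]
      rw [h2] at h1
      rw [limitCdf_of_neg hs]
      refine h1.trans ?_
      gcongr
  · exact key s t hs hst

theorem le_limitCdf_sub {s t : ℝ} (hs : 1 ≤ s) (hst : s ≤ t) (ht : t ≤ 3) :
    (weightMass l J)⁻¹ * Real.exp (-3 ^ (l + 1)) * (t - s) ≤ limitCdf l J t - limitCdf l J s := by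
  have hZ := weightMass_pos l J
  rw [limitCdf_sub (by linarith) hst, mul_assoc]
  gcongr
  have := intervalIntegral.integral_mono_on (μ := volume) hst
    (intervalIntegrable_const (c := Real.exp (-3 ^ (l + 1))))
    (continuous_weight (l := l) (J := J).intervalIntegrable s t)
    fun x hx => ?_
  · refine le_trans (le_of_eq ?_) this
    simp; ring
  · have hx1 : 1 ≤ x := hs.trans hx.1
    have hx3 : x ≤ 3 := hx.2.trans ht
    have h1 : 1 ≤ x ^ J := one_le_pow₀ hx1
    have h2 : Real.exp (-3 ^ (l + 1)) ≤ Real.exp (-x ^ (l + 1)) := by gcongr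
    unfold weight
    nlinarith [Real.exp_pos (-x ^ (l + 1))]

/-! ### From pointwise estimates to distribution functions. -/

/-- Both quantities lie between `x ^ J * shape l μ (i + 1)` and `z ^ J * shape l μ i` with `z = x +
(J + 1) / μ`, so it suffices to bound that spread. -/
theorem exists_discretization_le (l J : ℕ) : ∃ C : ℝ, 1 ≤ C ∧ ∀ (μ : ℝ) (i : ℕ), 1 ≤ μ →
    |((i + 1).ascFactorial J : ℝ) / μ ^ J * shape l μ i -
      μ * ∫ x in ((i : ℝ) / μ)..(((i + 1 : ℕ) : ℝ) / μ), weight l J x| ≤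
      C / (μ * relSize μ i ^ 2) := by
  set A : ℝ := J * (J + 2) ^ (J - 1) * (J + 1) with hA
  set B : ℝ := (l + 1) * 2 ^ l with hB
  set F : ℝ := (J + l + 2).factorial * Real.exp 2 with hF
  have hA0 : 0 ≤ A := by positivity
  have hB0 : 0 ≤ B := by positivity
  have hF0 : 0 ≤ F := by positivity
  refine ⟨1 + (A + B) * F, by linarith [mul_nonneg (add_nonneg hA0 hB0) hF0], fun μ i hμ1 => ?_⟩
  have hμ : 0 < μ := by linarith
  have hX := one_le_relSize hμ i
  have hX0 := relSize_pos hμ i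
  have hyX' := relSize_succ_le hμ1 i
  have hw := shape_le (l := l) hμ (J + l + 2) i
  have hw0 : 0 < shape l μ i := shape_pos μ i
  have hw1 : 0 < shape l μ (i + 1) := shape_pos μ (i + 1)
  have hmono : shape l μ (i + 1) ≤ shape l μ i := shape_antitone hμ (Nat.le_succ i)
  set x : ℝ := (i : ℝ) / μ with hx
  set y : ℝ := ((i + 1 : ℕ) : ℝ) / μ with hy
  have hx0 : 0 ≤ x := by positivity
  have hyx : y - x = 1 / μ := by rw [hy, hx]; push_cast; ring
  have hinv : 0 < 1 / μ := by positivity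
  have hinv1 : 1 / μ ≤ 1 := by rw [div_le_one hμ]; exact hμ1
  have hxy : x ≤ y := by linarith
  have hxX : relSize μ i = 1 + x := rfl
  have hyX : relSize μ (i + 1) = 1 + y := rfl
  set X := relSize μ i with hXdef
  set z : ℝ := x + (J + 1) * (1 / μ) with hz
  have hJ := (Nat.cast_nonneg J : (0 : ℝ) ≤ J)
  have hxz : x ≤ z := by rw [hz]; linarith [show 0 ≤ ((J : ℝ) + 1) * (1 / μ) by positivity]
  have hyz : y ≤ z := by rw [hz]; nlinarith
  have hzX : z ≤ (J + 2) * X := by rw [hz, hxX]; nlinarith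
  have hup : shape l μ i - shape l μ (i + 1) ≤ (l + 1) * y ^ l * (y - x) * shape l μ i :=
    exp_neg_pow_sub_le hx0 hxy l
  rw [hyx] at hup
  have hspread : z ^ J * shape l μ i - x ^ J * shape l μ (i + 1) ≤ (A + B) * F / (μ * X ^ 2) := by
    have h1 := pow_sub_pow_le hx0 hxz J
    have h2 : z - x = (J + 1) * (1 / μ) := by rw [hz]; ring
    have hz0 : 0 ≤ z := hx0.trans hxz
    rw [h2] at h1
    have h3 : z ^ J - x ^ J ≤ A * X ^ (J + l) / μ := by
      calc _ ≤ _ := h1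
        _ ≤ J * ((J + 2) * X) ^ (J - 1) * ((J + 1) * (1 / μ)) := by gcongr
        _ = A * X ^ (J - 1) / μ := by rw [hA, mul_pow]; ring
        _ ≤ _ := by gcongr; omega
    have h4 : x ^ J * ((l + 1) * y ^ l * (1 / μ)) ≤ B * X ^ (J + l) / μ := by
      have hy0 : 0 ≤ y := hx0.trans hxy
      calc _ ≤ X ^ J * ((l + 1) * (2 * X) ^ l * (1 / μ)) := by
            gcongr
            · linarith
            · linarith
        _ = _ := by rw [hB, mul_pow]; ring
    calc _ = (z ^ J - x ^ J) * shape l μ i + x ^ J * (shape l μ i - shape l μ (i + 1)) := by ring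
      _ ≤ (z ^ J - x ^ J) * shape l μ i +
          x ^ J * ((l + 1) * y ^ l * (1 / μ) * shape l μ i) := by gcongr
      _ = ((z ^ J - x ^ J) + x ^ J * ((l + 1) * y ^ l * (1 / μ))) * shape l μ i := by ring
      _ ≤ (A * X ^ (J + l) / μ + B * X ^ (J + l) / μ) * (F / X ^ (J + l + 2)) := by
          gcongr
      _ = _ := by field_simp; ring
  have ha1 : x ^ J ≤ ((i + 1).ascFactorial J : ℝ) / μ ^ J := by
    rw [hx, div_pow]
    gcongr
    have h1 : ((i + 1 : ℕ) : ℝ) ^ J ≤ ((i + 1).ascFactorial J : ℝ) := by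
      exact_mod_cast Nat.pow_succ_le_ascFactorial (i + 1) J
    refine le_trans ?_ h1
    gcongr
    linarith
  have ha2 : ((i + 1).ascFactorial J : ℝ) / μ ^ J ≤ z ^ J := by
    have h1 : ((i + 1).ascFactorial J : ℝ) ≤ ((i + J : ℕ) : ℝ) ^ J := by
      exact_mod_cast Nat.ascFactorial_le_pow_add i J
    have h2 : z = ((i : ℝ) + J + 1) / μ := by rw [hz, hx]; ring
    rw [h2, div_pow]
    gcongr
    refine h1.trans ?_
    push_cast
    exact pow_le_pow_left₀ (by positivity) (by linarith) J
  have hint1 : x ^ J * shape l μ (i + 1) ≤ μ * ∫ u in x..y, weight l J u := by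
    have := intervalIntegral.integral_mono_on (μ := volume) hxy
      (intervalIntegrable_const (c := x ^ J * shape l μ (i + 1)))
      (continuous_weight (l := l) (J := J).intervalIntegrable x y) fun u hu => ?_
    · rw [intervalIntegral.integral_const, hyx, smul_eq_mul] at this
      calc _ = μ * (1 / μ * (x ^ J * shape l μ (i + 1))) := by field_simp
        _ ≤ _ := by gcongr
    · have hu0 : 0 ≤ u := hx0.trans hu.1
      have h1 : shape l μ (i + 1) ≤ Real.exp (-u ^ (l + 1)) := by
        unfold shape
        have := hu.2
        gcongr
      have h2 : x ^ J ≤ u ^ J := pow_le_pow_left₀ hx0 hu.1 J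
      unfold weight
      gcongr
  have hint2 : μ * ∫ u in x..y, weight l J u ≤ z ^ J * shape l μ i := by
    have := intervalIntegral.integral_mono_on (μ := volume) hxy
      (continuous_weight (l := l) (J := J).intervalIntegrable x y)
      (intervalIntegrable_const (c := z ^ J * shape l μ i)) fun u hu => ?_
    · rw [intervalIntegral.integral_const, hyx, smul_eq_mul] at this
      calc _ ≤ μ * (1 / μ * (z ^ J * shape l μ i)) := by gcongr
        _ = _ := by field_simp
    · have hu0 : 0 ≤ u := hx0.trans hu.1
      have h1 : Real.exp (-u ^ (l + 1)) ≤ shape l μ i := by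
        unfold shape
        have := hu.1
        gcongr
      have h2 : u ^ J ≤ z ^ J := pow_le_pow_left₀ hu0 (hu.2.trans hyz) J
      unfold weight
      gcongr
  have hs1 : x ^ J * shape l μ (i + 1) ≤ ((i + 1).ascFactorial J : ℝ) / μ ^ J * shape l μ i := by
    gcongr
  have hs2 : ((i + 1).ascFactorial J : ℝ) / μ ^ J * shape l μ i ≤ z ^ J * shape l μ i := by
    gcongr
  have hfin : (A + B) * F / (μ * X ^ 2) ≤ (1 + (A + B) * F) / (μ * X ^ 2) := by
    gcongr
    linarith
  rw [abs_le]
  constructor <;> linarith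

theorem exists_mass_sub_integral_le (hl : 1 ≤ l) (J : ℕ) : ∃ C : ℝ, 1 ≤ C ∧ ∀ m i : ℕ, l ≤ m →
    |mass l J (m + l) i - profile l J (m + l) 0 * scale l J (m + l) ^ (J + 1) / J.factorial *
      ∫ x in ((i : ℝ) / scale l J (m + l))..(((i + 1 : ℕ) : ℝ) / scale l J (m + l)),
        weight l J x| ≤ C / (scale l J (m + l) ^ 2 * relSize (scale l J (m + l)) i ^ 2) := by
  obtain ⟨C, hC, h⟩ := exists_profile_sub_shape_le hl J (J + 2)
  obtain ⟨D, hD, hd⟩ := exists_discretization_le l J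
  obtain ⟨U, hU, hu⟩ := exists_profile_zero_le l J
  refine ⟨(1 + J) ^ J * C + U * D, ?_, fun m i hm => ?_⟩
  · have h1 : (1 : ℝ) ≤ (1 + J) ^ J := one_le_pow₀ (by simp)
    have h2 : 0 ≤ U * D := by positivity
    nlinarith
  have hμ := scale_pos (l := l) (J := J) (m + l)
  have hμ1 := one_le_scale (l := l) (J := J) (m + l)
  have h' := h m i hm
  have hu' := hu (m + l)
  have hd' := hd _ i hμ1
  have hu0 := profile_nonneg (l := l) (J := J) (m + l) 0
  set μ := scale l J (m + l)
  have hX := relSize_pos hμ i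
  have hX1 := one_le_relSize hμ i
  have hcast := cast_le_mul_relSize hμ i
  set X := relSize μ i
  set I := ∫ x in ((i : ℝ) / μ)..(((i + 1 : ℕ) : ℝ) / μ), weight l J x
  have hf : (1 : ℝ) ≤ J.factorial := by exact_mod_cast Nat.factorial_pos J
  have hf0 : (0 : ℝ) < J.factorial := by linarith
  have hdiv : ∀ t : ℝ, 0 ≤ t → t / J.factorial ≤ t := fun t ht => div_le_self ht hf
  have ha : ((i + 1).ascFactorial J : ℝ) ≤ ((1 + J) * (μ * X)) ^ J := by
    have h1 : ((i + 1).ascFactorial J : ℝ) ≤ ((i + J : ℕ) : ℝ) ^ J := by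
      exact_mod_cast Nat.ascFactorial_le_pow_add i J
    refine h1.trans ?_
    push_cast
    gcongr
    have : 1 ≤ μ * X := by nlinarith
    nlinarith [(Nat.cast_nonneg J : (0 : ℝ) ≤ J)]
  have e : mass l J (m + l) i - profile l J (m + l) 0 * μ ^ (J + 1) / J.factorial * I =
      ((i + 1).ascFactorial J : ℝ) / J.factorial *
        (profile l J (m + l) i - profile l J (m + l) 0 * shape l μ i) +
      profile l J (m + l) 0 * μ ^ J / J.factorial *
        (((i + 1).ascFactorial J : ℝ) / μ ^ J * shape l μ i - μ * I) := by
    rw [mass]; field_simp; ring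
  rw [e]
  refine (abs_add_le _ _).trans ?_
  rw [abs_mul, abs_mul,
    abs_of_nonneg (show 0 ≤ ((i + 1).ascFactorial J : ℝ) / J.factorial by positivity),
    abs_of_nonneg (show 0 ≤ profile l J (m + l) 0 * μ ^ J / J.factorial by positivity)]
  have hA := (hdiv _ (Nat.cast_nonneg ((i + 1).ascFactorial J))).trans ha
  have hP : profile l J (m + l) 0 * μ ^ J / J.factorial ≤ U / μ := by
    refine (hdiv _ (by positivity)).trans ?_
    rw [le_div_iff₀ hμ, mul_assoc, ← pow_succ]
    exact hu'
  calc _ ≤ ((1 + J) * (μ * X)) ^ J * (C / (μ ^ (J + 2) * X ^ (J + 2))) +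
        U / μ * (D / (μ * X ^ 2)) :=
        add_le_add (mul_le_mul hA h' (abs_nonneg _) (by positivity))
          (mul_le_mul hP hd' (abs_nonneg _) (by positivity))
    _ = _ := by rw [mul_pow, mul_pow]; field_simp; ring

theorem exists_sum_mass_sub_limitCdf_le (hl : 1 ≤ l) (J : ℕ) : ∃ C : ℝ, 1 ≤ C ∧ ∀ m k : ℕ,
    l ≤ m → |∑ i ∈ Finset.range k, mass l J (m + l) i - limitCdf l J (k / scale l J (m + l))| ≤
      C / scale l J (m + l) := by
  obtain ⟨C, hC, h⟩ := exists_mass_sub_integral_le hl J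
  refine ⟨4 * C, by linarith, fun m k hm => ?_⟩
  have hμ := scale_pos (l := l) (J := J) (m + l)
  have hμ1 := one_le_scale (l := l) (J := J) (m + l)
  have h' := fun i => h m i hm
  set μ := scale l J (m + l)
  set a := profile l J (m + l) 0 * μ ^ (J + 1) / J.factorial
  have hZ := weightMass_pos l J
  have hint : ∀ k : ℕ, ∑ i ∈ Finset.range k,
      ∫ x in ((i : ℝ) / μ)..(((i + 1 : ℕ) : ℝ) / μ), weight l J x =
      weightMass l J * limitCdf l J (k / μ) := by
    intro k
    have h1 := intervalIntegral.sum_integral_adjacent_intervals (n := k) (μ := volume)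
      (f := weight l J) (a := fun i : ℕ => (i : ℝ) / μ)
      fun i _ => continuous_weight.intervalIntegrable _ _
    rw [h1, limitCdf_of_nonneg (by positivity)]
    simp only [Nat.cast_zero, zero_div]
    field_simp
  have hsum : ∀ k : ℕ, |∑ i ∈ Finset.range k, mass l J (m + l) i -
      a * weightMass l J * limitCdf l J (k / μ)| ≤ 2 * C / μ := by
    intro k
    rw [mul_assoc, ← hint, Finset.mul_sum, ← Finset.sum_sub_distrib]
    calc _ ≤ ∑ i ∈ Finset.range k, C / (μ ^ 2 * relSize μ i ^ 2) :=
          (Finset.abs_sum_le_sum_abs _ _).trans (Finset.sum_le_sum fun i _ => h' i)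
      _ = C / μ ^ 2 * ∑ i ∈ Finset.range k, 1 / relSize μ i ^ 2 := by
          rw [Finset.mul_sum]
          refine Finset.sum_congr rfl fun i _ => ?_
          have := relSize_pos hμ i
          field_simp
      _ ≤ C / μ ^ 2 * (2 * μ) := by gcongr; exact sum_one_div_relSize_sq_le hμ1 k
      _ = _ := by field_simp
  -- The leading constant need not be computed: both the masses and the limit law have total mass
  -- one, so letting `k` tend to infinity in `hsum` fixes it.
  have hnorm : |1 - a * weightMass l J| ≤ 2 * C / μ := by
    have hlim : Filter.Tendsto (fun k : ℕ => |1 - a * weightMass l J * limitCdf l J (k / μ)|)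
        Filter.atTop (nhds |1 - a * weightMass l J * 1|) := by
      have h1 : Filter.Tendsto (fun k : ℕ => (k : ℝ) / μ) Filter.atTop Filter.atTop :=
        tendsto_natCast_atTop_atTop.atTop_div_const hμ
      have h2 : Filter.Tendsto (fun k : ℕ => limitCdf l J (k / μ)) Filter.atTop (nhds 1) :=
        tendsto_limitCdf.comp h1
      exact ((h2.const_mul (a * weightMass l J)).const_sub 1).abs
    rw [mul_one] at hlim
    refine le_of_tendsto hlim ?_
    filter_upwards [Filter.eventually_ge_atTop (m + l + 1)] with k hk
    have h1 : ∑ i ∈ Finset.range k, mass l J (m + l) i = 1 := by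
      rw [← sum_mass (l := l) (J := J) (m + l)]
      refine (Finset.sum_subset (Finset.range_mono hk) fun i _ hi => mass_eq_zero ?_).symm
      rw [Finset.mem_range] at hi
      omega
    rw [← h1]
    exact hsum k
  have hG0 := limitCdf_nonneg (l := l) (J := J) (k / μ)
  have hG1 := limitCdf_le_one (l := l) (J := J) (k / μ)
  calc _ = |(∑ i ∈ Finset.range k, mass l J (m + l) i -
        a * weightMass l J * limitCdf l J (k / μ)) +
        -((1 - a * weightMass l J) * limitCdf l J (k / μ))| := by congr 1; ring
    _ ≤ 2 * C / μ + 2 * C / μ := by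
        refine (abs_add_le _ _).trans (add_le_add (hsum k) ?_)
        rw [abs_neg, abs_mul, abs_of_nonneg hG0]
        exact (mul_le_of_le_one_right (abs_nonneg _) hG1).trans hnorm
    _ = _ := by ring

/-! ### Identification of the masses with the law of the urn. -/

theorem tsum_bind_mul {α β : Type*} (p : PMF α) (q : α → PMF β) (f : β → ENNReal) :
    ∑' b, p.bind q b * f b = ∑' a, p a * ∑' b, q a b * f b := by
  simp only [PMF.bind_apply, ← ENNReal.tsum_mul_right, ← ENNReal.tsum_mul_left, mul_assoc]
  exact ENNReal.tsum_comm

theorem tsum_pure_mul {α : Type*} (a : α) (f : α → ENNReal) :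
    ∑' b, PMF.pure a b * f b = f a := by
  rw [tsum_eq_single a fun b hb => by simp [PMF.pure_apply, hb]]
  simp

theorem tsum_urnStep_mul (e : ℕ) (s : ℕ × ℕ) (f : ℕ × ℕ → ENNReal) :
    ∑' t, urnStep e s t * f t = (whiteProb s.1 s.2 : ENNReal) * f (s.1 + e, s.2 + 1) +
      ((1 - whiteProb s.1 s.2 : ℝ≥0) : ENNReal) * f (s.1 + 1 + e, s.2) := by
  rw [urnStep, PMF.map, tsum_bind_mul]
  simp only [Function.comp_apply, tsum_pure_mul]
  rw [tsum_fintype, Fintype.sum_bool]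
  simp [drawnColor]

theorem total_succ (n : ℕ) :
    total l J (n + 1) = total l J n + 1 + if l ∣ n + 1 then 1 else 0 := by
  unfold total
  rw [Nat.succ_div]
  ring

/-- The total is deterministic, so the white count determines the contents. A general test function
`f` carries the induction through the bind. -/
theorem tsum_urnState_mul (n : ℕ) (f : ℕ × ℕ → ENNReal) :
    ∑' s, urnState l 1 (J + 1) n s * f s = ∑ i ∈ Finset.range (n + 1),
      ENNReal.ofReal (mass l J n i) * f (total l J n - (i + J + 1), i + J + 1) := by
  induction n generalizing f with
  | zero =>
    rw [urnState, tsum_pure_mul]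
    have h0 : mass l J 0 0 = 1 := by
      have := sum_mass (l := l) (J := J) 0
      simpa using this
    have hT : total l J 0 = J + 2 := by simp [total]
    rw [Finset.sum_range_one, h0, hT, zero_add, ENNReal.ofReal_one, one_mul,
      show J + 2 - (J + 1) = 1 by omega]
  | succ n ih =>
    rw [urnState, tsum_bind_mul, ih]
    simp only [tsum_urnStep_mul]
    set e := if l ∣ n + 1 then 1 else 0 with he
    have hT := total_pos (l := l) (J := J) n
    set x : ℕ → ℝ := fun i => ((i : ℝ) + J + 1) / total l J n with hx
    have hx0 : ∀ i, 0 ≤ x i := fun i => by simp only [hx]; positivity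
    have hle : ∀ i, i ≤ n → i + J + 1 ≤ total l J n := fun i hi => by
      have := le_cast_total (l := l) (J := J) n
      have h' : n + J + 2 ≤ total l J n := by exact_mod_cast this
      omega
    have hx1 : ∀ i, i ≤ n → x i ≤ 1 := fun i hi => by
      simp only [hx]
      rw [div_le_one hT]
      exact_mod_cast hle i hi
    have hwp : ∀ i, i ≤ n → whiteProb (total l J n - (i + J + 1)) (i + J + 1) =
        Real.toNNReal (x i) := fun i hi => by
      apply NNReal.coe_injective
      rw [Real.coe_toNNReal _ (hx0 i)]
      simp only [whiteProb, hx]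
      push_cast [Nat.cast_sub (hle i hi)]
      rw [NNReal.coe_sub (by exact_mod_cast hle i hi)]
      push_cast
      rw [sub_add_cancel]
    set F : ℕ → ENNReal := fun i => f (total l J (n + 1) - (i + J + 1), i + J + 1) with hF
    have hnn : ∀ i, 0 ≤ mass l J n i * (1 - x i) := fun i => by
      rcases le_or_gt i n with hi | hi
      · exact mul_nonneg (mass_nonneg n i) (sub_nonneg.2 (hx1 i hi))
      · simp [mass_eq_zero hi]
    have hL : ∀ i ∈ Finset.range (n + 1), ENNReal.ofReal (mass l J n i) *
        ((whiteProb (total l J n - (i + J + 1)) (i + J + 1) : ENNReal) *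
            f (total l J n - (i + J + 1) + e, i + J + 1 + 1) +
          ((1 - whiteProb (total l J n - (i + J + 1)) (i + J + 1) : ℝ≥0) : ENNReal) *
            f (total l J n - (i + J + 1) + 1 + e, i + J + 1)) =
        ENNReal.ofReal (mass l J n i * x i) * F (i + 1) +
          ENNReal.ofReal (mass l J n i * (1 - x i)) * F i := fun i hi => by
      have hi' : i ≤ n := by simpa [Nat.lt_succ_iff] using hi
      have h1 := hle i hi'
      have e1 : total l J (n + 1) - (i + 1 + J + 1) = total l J n - (i + J + 1) + e := by
        rw [total_succ, ← he]; omega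
      have e2 : total l J (n + 1) - (i + J + 1) = total l J n - (i + J + 1) + 1 + e := by
        rw [total_succ, ← he]; omega
      simp only [hF]
      rw [hwp i hi', e1, e2, show i + 1 + J + 1 = i + J + 1 + 1 by ring,
        ENNReal.ofReal_mul (mass_nonneg n i), ENNReal.ofReal_mul (mass_nonneg n i), mul_add,
        mul_assoc, mul_assoc]
      congr 3
      rw [ENNReal.ofReal, NNReal.sub_def, Real.coe_toNNReal _ (hx0 i), NNReal.coe_one]
    rw [Finset.sum_congr rfl hL, Finset.sum_add_distrib]
    have hR : ∀ i, ENNReal.ofReal (mass l J (n + 1) (i + 1)) * F (i + 1) =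
        ENNReal.ofReal (mass l J n (i + 1) * (1 - x (i + 1))) * F (i + 1) +
        ENNReal.ofReal (mass l J n i * x i) * F (i + 1) := fun i => by
      rw [mass_succ_succ, ENNReal.ofReal_add (hnn (i + 1))
        (mul_nonneg (mass_nonneg n i) (hx0 i)), add_mul]
    have hz := Finset.sum_range_succ'
      (fun i => ENNReal.ofReal (mass l J n i * (1 - x i)) * F i) (n + 1)
    rw [Finset.sum_range_succ, mass_eq_zero (Nat.lt_succ_self n), zero_mul, ENNReal.ofReal_zero,
      zero_mul, add_zero] at hz
    have hm0 : mass l J (n + 1) 0 = mass l J n 0 * (1 - x 0) := by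
      rw [mass_succ_zero]; simp [hx]
    change _ = ∑ i ∈ Finset.range (n + 1 + 1), ENNReal.ofReal (mass l J (n + 1) i) * F i
    rw [Finset.sum_range_succ' _ (n + 1), Finset.sum_congr rfl fun i _ => hR i,
      Finset.sum_add_distrib, hz, hm0]
    abel

theorem whiteLaw_eq_sum (n : ℕ) : whiteLaw l 1 (J + 1) n = ∑ i ∈ Finset.range (n + 1),
    ENNReal.ofReal (mass l J n i) • Measure.dirac ((i : ℝ) + J + 1) := by
  ext A hA
  have hm : Measurable fun s : ℕ × ℕ => (s.2 : ℝ) := Measurable.of_discrete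
  rw [whiteLaw, Measure.map_apply hm hA, PMF.toMeasure_apply _ (hm hA)]
  have h := tsum_urnState_mul (l := l) (J := J) n
    (((fun s : ℕ × ℕ => (s.2 : ℝ)) ⁻¹' A).indicator 1)
  have e : ∀ s, ((fun s : ℕ × ℕ => (s.2 : ℝ)) ⁻¹' A).indicator (urnState l 1 (J + 1) n) s =
      urnState l 1 (J + 1) n s * ((fun s : ℕ × ℕ => (s.2 : ℝ)) ⁻¹' A).indicator 1 s := by
    intro s
    by_cases hs : s ∈ (fun s : ℕ × ℕ => (s.2 : ℝ)) ⁻¹' A <;> simp [hs]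
  rw [tsum_congr e, h, Measure.finsetSum_apply]
  refine Finset.sum_congr rfl fun i _ => ?_
  rw [Measure.smul_apply, Measure.dirac_apply' _ hA, smul_eq_mul]
  congr 1
  by_cases hs : (i : ℝ) + J + 1 ∈ A <;> simp [Set.indicator, hs]

theorem urnScale_eq (n : ℕ) : urnScale (J + 1) l n = scale l J n := by
  have h : ∫ x, x ^ (l + 1) ∂(whiteLaw l 1 (J + 1) n) = rawMoment l J n := by
    rw [whiteLaw_eq_sum, integral_finsetSum_measure]
    · refine Finset.sum_congr rfl fun i _ => ?_
      rw [integral_smul_measure, integral_dirac, ENNReal.toReal_ofReal (mass_nonneg n i),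
        smul_eq_mul]
    · intro i _
      exact Integrable.smul_measure (integrable_dirac (by simp)) ENNReal.ofReal_ne_top
  rw [urnScale, h, scale]
  push_cast
  rfl

theorem real_map_whiteLaw_Iic (n : ℕ) {μ : ℝ} (hμ : 0 < μ) (t : ℝ) :
    ((whiteLaw l 1 (J + 1) n).map (fun x : ℝ => x / μ)).real (Set.Iic t) =
      ∑ i ∈ Finset.range (⌊t * μ⌋₊ - J), mass l J n i := by
  have hm : Measurable fun x : ℝ => x / μ := by fun_prop
  rw [map_measureReal_apply hm measurableSet_Iic, measureReal_def, whiteLaw_eq_sum,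
    Measure.finsetSum_apply]
  have hterm : ∀ i, (ENNReal.ofReal (mass l J n i) • Measure.dirac ((i : ℝ) + J + 1))
      ((fun x : ℝ => x / μ) ⁻¹' Set.Iic t) =
      ENNReal.ofReal (if i < ⌊t * μ⌋₊ - J then mass l J n i else 0) := by
    intro i
    rw [Measure.smul_apply, Measure.dirac_apply' _ (hm measurableSet_Iic), smul_eq_mul]
    -- As `i + J + 1` is positive, the natural floor is right for negative `t` as well, and the
    -- truncated subtraction gives an empty range when no mass lies below `t`.
    have hiff : (i : ℝ) + J + 1 ∈ (fun x : ℝ => x / μ) ⁻¹' Set.Iic t ↔ i < ⌊t * μ⌋₊ - J := by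
      rw [Set.mem_preimage, Set.mem_Iic, div_le_iff₀ hμ]
      have h1 : (i : ℝ) + J + 1 = ((i + J + 1 : ℕ) : ℝ) := by push_cast; ring
      rw [h1, ← Nat.le_floor_iff' (by omega)]
      omega
    by_cases h : i < ⌊t * μ⌋₊ - J
    · rw [Set.indicator_of_mem (hiff.2 h), if_pos h]; simp
    · rw [Set.indicator_of_notMem (fun h' => h (hiff.1 h')), if_neg h]; simp
  have hnn : ∀ i, 0 ≤ if i < ⌊t * μ⌋₊ - J then mass l J n i else 0 := fun i => by
    split_ifs
    · exact mass_nonneg n i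
    · exact le_rfl
  rw [Finset.sum_congr rfl fun i _ => hterm i, ← ENNReal.ofReal_sum_of_nonneg fun i _ => hnn i,
    ENNReal.toReal_ofReal (Finset.sum_nonneg fun i _ => hnn i), ← Finset.sum_filter]
  refine Finset.sum_subset (fun i hi => by simpa using (Finset.mem_filter.1 hi).2)
    fun i hi hi' => ?_
  refine mass_eq_zero ?_
  by_contra hcon
  exact hi' (Finset.mem_filter.2 ⟨by simp; omega, by simpa using hi⟩)

/-! ### Order of the scaling and bounds on the Kolmogorov distance. -/

theorem exists_scale_asymptotics (hl : 1 ≤ l) (J : ℕ) : ∃ a A : ℝ, 0 < a ∧ 0 < A ∧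
    ∀ n : ℕ, 1 ≤ n → a * (n : ℝ) ^ ((l : ℝ) / ((l : ℝ) + 1)) ≤ scale l J n ∧
      scale l J n ≤ A * (n : ℝ) ^ ((l : ℝ) / ((l : ℝ) + 1)) := by
  obtain ⟨K, hK, h⟩ := exists_scale_growth l J
  obtain ⟨a, A, ha, hA, hg⟩ := exists_growth_bounds hl J
  set b : ℝ := 1 + K / a
  have hb : 1 ≤ b := by
    have : 0 ≤ K / a := by positivity
    linarith
  refine ⟨1 / b, K * (1 + A), by positivity, by positivity, fun n hn => ?_⟩
  obtain ⟨g1, g2⟩ := hg n hn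
  obtain ⟨s1, s2⟩ := h n
  have hs := scale_pos (l := l) (J := J) n
  set N : ℝ := (n : ℝ) ^ ((l : ℝ) / ((l : ℝ) + 1))
  have hN0 : 0 ≤ N := by positivity
  have hN : N ^ (l + 1) = (n : ℝ) ^ l := by
    rw [← Real.rpow_natCast, ← Real.rpow_mul (Nat.cast_nonneg n), ← Real.rpow_natCast]
    congr 1
    push_cast
    field_simp
  rw [← hN] at g1 g2
  constructor
  · rw [one_div, inv_mul_le_iff₀ (by linarith)]
    refine le_of_pow_succ_le l hs.le hb ?_
    have h1 : N ^ (l + 1) ≤ K / a * scale l J n ^ (l + 1) := by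
      rw [div_mul_eq_mul_div, le_div_iff₀ ha, mul_comm]
      exact g1.trans s2
    refine h1.trans ?_
    gcongr
    simp [b]
  · refine le_of_pow_succ_le l hN0 (by nlinarith) (s1.trans ?_)
    rw [mul_assoc]
    gcongr
    refine g2.trans ?_
    gcongr
    linarith

/-- The distribution function of the rescaled number of white balls. -/
noncomputable def urnCdf (l J n : ℕ) (t : ℝ) : ℝ :=
  ∑ i ∈ Finset.range (⌊t * scale l J n⌋₊ - J), mass l J n i

theorem urnCdf_nonneg (n : ℕ) (t : ℝ) : 0 ≤ urnCdf l J n t :=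
  Finset.sum_nonneg fun i _ => mass_nonneg n i

theorem abs_urnCdf_sub_limitCdf_le_one (n : ℕ) (t : ℝ) :
    |urnCdf l J n t - limitCdf l J t| ≤ 1 := by
  have h1 := urnCdf_nonneg (l := l) (J := J) n t
  have h2 : urnCdf l J n t ≤ 1 := sum_mass_le_one n _
  have h3 := limitCdf_nonneg (l := l) (J := J) t
  have h4 := limitCdf_le_one (l := l) (J := J) t
  rw [abs_le]
  constructor <;> linarith

theorem kolmogorovDist_eq (n : ℕ) :
    kolmogorovDist ((whiteLaw l 1 (J + 1) n).map (fun x : ℝ => x / scale l J n))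
      (genGamma ((J : ℝ) + 1) ((l : ℝ) + 1)) = ⨆ t : ℝ, |urnCdf l J n t - limitCdf l J t| := by
  unfold kolmogorovDist
  congr 1
  funext t
  rw [real_map_whiteLaw_Iic n (scale_pos n)]
  rfl

/-- Replacing `t` by the lattice point `k / μ` moves it by at most `(J + 1) / μ` when `t ≥ 0`, and
the limit distribution function is Lipschitz. -/
theorem exists_abs_urnCdf_sub_limitCdf_le (hl : 1 ≤ l) (J : ℕ) : ∃ C : ℝ, 1 ≤ C ∧
    ∀ (m : ℕ) (t : ℝ), l ≤ m →
      |urnCdf l J (m + l) t - limitCdf l J t| ≤ C / scale l J (m + l) := by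
  obtain ⟨C, hC, h⟩ := exists_sum_mass_sub_limitCdf_le hl J
  set L : ℝ := (weightMass l J)⁻¹ * (J.factorial * Real.exp 2)
  have hL : 0 ≤ L := by have := weightMass_pos l J; positivity
  refine ⟨C + L * (J + 1), by linarith [show 0 ≤ L * ((J : ℝ) + 1) by positivity],
    fun m t hm => ?_⟩
  have hμ := scale_pos (l := l) (J := J) (m + l)
  have h1 := h m (⌊t * scale l J (m + l)⌋₊ - J) hm
  simp only [urnCdf]
  set μ := scale l J (m + l)
  set k := ⌊t * μ⌋₊ - J with hk
  have h2 : |limitCdf l J (k / μ) - limitCdf l J t| ≤ L * (J + 1) / μ := by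
    rcases lt_or_ge t 0 with ht | ht
    · have hk0 : k = 0 := by
        rw [hk, Nat.floor_of_nonpos (by nlinarith), Nat.zero_sub]
      rw [hk0, limitCdf_of_neg ht, limitCdf_of_nonneg (by simp)]
      simp
      positivity
    · have hf1 := Nat.floor_le (show 0 ≤ t * μ by positivity)
      have hf2 := Nat.lt_floor_add_one (t * μ)
      have hk2 : ((⌊t * μ⌋₊ : ℕ) : ℝ) ≤ (k : ℝ) + J := by
        exact_mod_cast (by omega : ⌊t * μ⌋₊ ≤ k + J)
      rcases le_total ((k : ℝ) / μ) t with hkt | hkt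
      · rw [abs_sub_comm, abs_of_nonneg (sub_nonneg.2 (limitCdf_mono hkt))]
        refine (limitCdf_sub_le hkt).trans ?_
        rw [mul_div_assoc]
        refine mul_le_mul_of_nonneg_left ?_ hL
        rw [le_div_iff₀ hμ, sub_mul, div_mul_cancel₀ _ hμ.ne']
        linarith
      · have hk1 : (k : ℝ) ≤ ((⌊t * μ⌋₊ : ℕ) : ℝ) := by exact_mod_cast Nat.sub_le _ _
        have : (k : ℝ) / μ = t := le_antisymm (by rw [div_le_iff₀ hμ]; linarith) hkt
        rw [this, sub_self, abs_zero]
        positivity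
  calc _ ≤ _ + _ := abs_sub_le _ (limitCdf l J (k / μ)) _
    _ ≤ C / μ + L * (J + 1) / μ := add_le_add h1 h2
    _ = _ := by ring

/-- The urn's distribution function is equal at `k / μ` and `(k + 1/2) / μ`, while the limit's grows
between them by a multiple of `1/μ`; at one of the two points they differ by at least half of that.
-/
theorem exists_le_iSup_abs_sub (l J : ℕ) : ∃ c : ℝ, 0 < c ∧ ∀ n : ℕ,
    c / scale l J n ≤ ⨆ t : ℝ, |urnCdf l J n t - limitCdf l J t| := by
  have hZ := weightMass_pos l J
  set c : ℝ := (weightMass l J)⁻¹ * Real.exp (-3 ^ (l + 1))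
  have hc : 0 < c := by positivity
  refine ⟨c / 4, by positivity, fun n => ?_⟩
  have hμ := scale_pos (l := l) (J := J) n
  have hμ1 := one_le_scale (l := l) (J := J) n
  have hbdd : BddAbove (Set.range fun t : ℝ => |urnCdf l J n t - limitCdf l J t|) :=
    ⟨1, by rintro _ ⟨t, rfl⟩; exact abs_urnCdf_sub_limitCdf_le_one n t⟩
  set S := ⨆ t : ℝ, |urnCdf l J n t - limitCdf l J t|
  have hS : ∀ t : ℝ, |urnCdf l J n t - limitCdf l J t| ≤ S := fun t => le_ciSup hbdd t
  have heq : ∀ k : ℕ, urnCdf l J n (((k : ℝ) + 1 / 2) / scale l J n) =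
      urnCdf l J n (k / scale l J n) := fun k => by
    have h1 : ⌊(k : ℝ) + 1 / 2⌋₊ = k := by
      rw [Nat.floor_eq_iff (by positivity)]
      constructor <;> linarith
    simp only [urnCdf]
    rw [div_mul_cancel₀ _ hμ.ne', div_mul_cancel₀ _ hμ.ne', h1, Nat.floor_natCast]
  set μ := scale l J n
  -- Since `μ ≥ 1`, this puts both points in `[1, 3]`, where the limit density is bounded below.
  set k := ⌈μ⌉₊
  have hk1 : μ ≤ k := Nat.le_ceil μ
  have hk2 : (k : ℝ) < μ + 1 := Nat.ceil_lt_add_one hμ.le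
  have h1 := le_limitCdf_sub (l := l) (J := J) (s := k / μ) (t := ((k : ℝ) + 1 / 2) / μ)
    (by rw [le_div_iff₀ hμ]; linarith) (by gcongr; linarith)
    (by rw [div_le_iff₀ hμ]; linarith)
  have h2 : ((k : ℝ) + 1 / 2) / μ - k / μ = 1 / 2 / μ := by ring
  rw [h2] at h1
  have h3 := hS (k / μ)
  have h4 := hS (((k : ℝ) + 1 / 2) / μ)
  rw [heq k] at h4
  rw [abs_le] at h3 h4
  have h5 : c / 4 / μ = c * (1 / 2 / μ) / 2 := by ring
  rw [h5]
  linarith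

end ImmigrationUrn

open ImmigrationUrn

theorem theorem1 (j l : ℕ) (hj : 1 ≤ j) (hl : 1 ≤ l) :
    (∃ a A : ℝ, 0 < a ∧ 0 < A ∧ ∀ n : ℕ, 1 ≤ n →
      a * (n : ℝ) ^ ((l : ℝ) / ((l : ℝ) + 1)) ≤ urnScale j l n ∧
      urnScale j l n ≤ A * (n : ℝ) ^ ((l : ℝ) / ((l : ℝ) + 1))) ∧
    (∃ c C : ℝ, 0 < c ∧ 0 < C ∧ ∀ n : ℕ, 1 ≤ n →
      c * (n : ℝ) ^ (-((l : ℝ) / ((l : ℝ) + 1))) ≤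
        kolmogorovDist ((whiteLaw l 1 j n).map (fun x : ℝ => x / urnScale j l n))
          (genGamma (j : ℝ) ((l : ℝ) + 1)) ∧
      kolmogorovDist ((whiteLaw l 1 j n).map (fun x : ℝ => x / urnScale j l n))
          (genGamma (j : ℝ) ((l : ℝ) + 1)) ≤
        C * (n : ℝ) ^ (-((l : ℝ) / ((l : ℝ) + 1)))) := by
  obtain ⟨J, rfl⟩ := Nat.exists_eq_add_of_le' hj
  simp only [urnScale_eq]
  push_cast
  simp only [kolmogorovDist_eq]
  obtain ⟨a, A, ha, hA, hscale⟩ := exists_scale_asymptotics hl J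
  refine ⟨⟨a, A, ha, hA, hscale⟩, ?_⟩
  obtain ⟨c, hc, hlow⟩ := exists_le_iSup_abs_sub l J
  obtain ⟨C, hC, hup⟩ := exists_abs_urnCdf_sub_limitCdf_le hl J
  -- The summand `2 * l` covers `n < 2 * l`, where the distance is at most one and `N ≤ n`. For
  -- larger `n`, writing `n = m + l` leaves `m ≥ l`, as the difference estimates require.
  refine ⟨c / A, C / a + 2 * l, by positivity, by positivity, fun n hn => ?_⟩
  obtain ⟨s1, s2⟩ := hscale n hn
  have hn0 : (0 : ℝ) < n := by exact_mod_cast hn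
  have hμ := scale_pos (l := l) (J := J) n
  rw [Real.rpow_neg hn0.le]
  set N : ℝ := (n : ℝ) ^ ((l : ℝ) / ((l : ℝ) + 1)) with hN
  have hN0 : 0 < N := by positivity
  constructor
  · refine le_trans ?_ (hlow n)
    rw [div_mul_eq_mul_div, ← div_eq_mul_inv, div_div]
    gcongr
    linarith
  · refine ciSup_le fun t => ?_
    rcases lt_or_ge n (2 * l) with h | h
    · refine (abs_urnCdf_sub_limitCdf_le_one n t).trans ?_
      rw [← div_eq_mul_inv, le_div_iff₀ hN0, one_mul]
      have h1 : N ≤ n := by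
        have hn1 : (1 : ℝ) ≤ n := by exact_mod_cast hn
        calc N ≤ (n : ℝ) ^ (1 : ℝ) := by
              refine Real.rpow_le_rpow_of_exponent_le hn1 ?_
              rw [div_le_one (by positivity)]
              linarith
          _ = n := Real.rpow_one _
      have h2 : (n : ℝ) ≤ 2 * l := by exact_mod_cast h.le
      have h3 : 0 ≤ C / a := by positivity
      linarith
    · obtain ⟨m, rfl⟩ := Nat.exists_eq_add_of_le' (show l ≤ n by omega)
      refine (hup m t (by omega)).trans ?_
      calc C / scale l J (m + l) ≤ C / (a * N) := by gcongr
        _ = C / a * N⁻¹ := by field_simp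
        _ ≤ _ := by
            gcongr
            linarith [(Nat.cast_nonneg l : (0 : ℝ) ≤ l)]
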